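/- **Setting.** Let $\mathbb F_q$ be a finite field and $n$ a positive integer. For $v(D)\in\mathbb F_q[D]^n$, $\operatorname{wt}(v(D))$ is the total number of nonzero coefficients of its entries; $\langle u(D)\mid v(D)\rangle=\sum_t u_t\cdot v_t$ is the Euclidean inner product of the coefficient sequences. A matrix $G(D)\in\mathbb F_q[D]^{k\times N}$ is *basic* if it has a polynomial right inverse, and *reduced basic* if moreover its overall constraint length $\sum_i\max_j\deg g_{ij}$ is the least one among all basic generator matrices of the code $V=\{u(D)G(D)\}$; that number is then the *degree* of $V$, and $\max_{i,j}\deg g_{ij}$ is the *memory*. The free distance of $V$ is the least weight of a nonzero codeword. The Euclidean dual $V^\perp$ is the convolutional code of all $u(D)\in\mathbb F_q[D]^n$ with $\langle D^k u(D)\mid v(D)\rangle=0$ for all $k\ge0$ and $v(D)\in V$, equivalently $\sum_j u_j(D)v_j(1/D)=0$ for all $v(D)\in V$. Minima over empty sets are $\infty$. An asymmetric quantum convolutional code (AQCC) with parameters $[(n,K,\mu^*;\gamma,d_z/d_x)]_q$ is given by a reduced basic stabilizer matrix $S(D)=(X(D)\mid Z(D))\in\mathbb F_q[D]^{(n-K)\times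 2n}$ with $X(D)Z(1/D)^t-Z(D)X(1/D)^t=0$, of memory $\mu^*$ and degree $\gamma$. An error $e=(a(D)\mid b(D))$ ($a$: qudit flips, $b$: phase shifts) is undetectable if it is not in the row module of $S(D)$ but $e$ and all its time shifts are symplectically orthogonal to that module. The distances $d_z/d_x$ mean: every error with $\operatorname{wt}(a)<d_x$ and $\operatorname{wt}(b)<d_z$ is detectable, some $(a\mid 0)$ with $\operatorname{wt}(a)=d_x$ is undetectable, and some $(0\mid b)$ with $\operatorname{wt}(b)=d_z$ is undetectable. **Theorem 1 (General Construction).** Let $m<n$ linearly independent vectors of $\mathbb F_q^n$ be given, split into blocks (the rows of) $H_0,H_0',H_1,H_1',\dots,H_\mu,H_\mu'$, where $\mu\ge0$, $\operatorname{rk}H_0=\dots=\operatorname{rk}H_\mu\ge1$ and $\operatorname{rk}H_0'\ge\operatorname{rk}H_1'\ge\dots\ge\operatorname{rk}H_\mu'$. Let $\tilde H_i'$ be $H_i'$ with zero rows added at the bottom up to $\operatorname{rk}H_0'$ rows in total, and put $$G_1(D)=\sum_{i=0}^{\mu}\begin{bmatrix}H_i\\ \tilde H_i'\end{bmatrix}D^i,\qquad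 G_2(D)=\sum_{i=0}^{\mu}\tilde H_i'D^i .$$ Let $V_1,V_2$ be the convolutional codes generated by $G_1(D)$ and $G_2(D)$; $(d_1)_f$ the free distance of $V_1$ and $(d_2)_f^\perp$ that of $V_2^\perp$; $d^\perp$ the minimum distance of $C^\perp$, where $C$ is the block code whose parity check matrix consists of all $m$ vectors; $d^*$, $d_0'$ and $d_\mu'$ the minimum distances of the block codes with parity check matrices $[H_0';H_1';\dots;H_\mu']$, $H_0'$ and $\tilde H_\mu'$. Then: 1. $G_1(D)$ and $G_2(D)$ are reduced basic and $V_2\subsetneq V_1$. The degrees of $V_1$ and $V_2$ are $$\gamma_1=\mu(\operatorname{rk}H_\mu+\operatorname{rk}H_\mu')+\sum_{i=1}^{\mu-1}(\mu-i)\big[\operatorname{rk}H_{\mu-i}'-\operatorname{rk}H_{\mu-i+1}'\big],\qquad \gamma_2=\mu\operatorname{rk}H_\mu'+\sum_{i=1}^{\mu-1}(\mu-i)\big[\operatorname{rk}H_{\mu-i}'-\operatorname{rk}H_{\mu-i+1}'\big].$$ $V_1$ has memory $\mu$, and so has $V_2$ if $H_\mu'$ is not empty. 2. Let $d_x=\operatorname{wt}(V_1\setminus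 V_2)$ and $d_z=\operatorname{wt}(V_2^\perp\setminus V_1^\perp)$ (least weights). These are finite, and $$d_x\ge(d_1)_f\ge d^\perp,\qquad d_z\ge(d_2)_f^\perp,\qquad \min\{d_0'+d_\mu',\,d^*\}\le(d_2)_f^\perp\le d^* .$$ 3. $V_1^\perp$ has a reduced basic generator matrix with $n-\operatorname{rk}H_0-\operatorname{rk}H_0'$ rows. For every such matrix $H_1(D)$ (not to be confused with the block $H_1$), $$\begin{pmatrix}G_2(D)&|&0\\0&|&H_1(D)\end{pmatrix}$$ is a stabilizer matrix of an AQCC with parameters $[(n,\operatorname{rk}H_0,\mu^*;\gamma_1+\gamma_2,\,d_z/d_x)]_q$, where $\mu^*$ is its memory; exchanging $G_2(D)$ and $H_1(D)$ in it gives an AQCC with the same parameters except that the values of $d_z$ and $d_x$ are exchanged (so that the larger one can always be taken as the phase-shift distance). -/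

import Mathlib

open Polynomial

namespace AQCC

variable {F : Type*} [Field F] {n : ℕ}

/-! Linear block codes of length `n` over `F`. -/

/-- The linear block code with parity check matrix `A`, i.e. `{v | A v = 0}`. -/
def codeOfParityCheck {ι : Type*} (A : Matrix ι (Fin n) F) : Submodule F (Fin n → F) :=
  LinearMap.ker A.mulVecLin

/-- The Euclidean dual of a block code. -/
def blockDual (C : Submodule F (Fin n → F)) : Submodule F (Fin n → F) where
  carrier := {u | ∀ v ∈ C, u ⬝ᵥ v = 0}
  add_mem' := by
    intro a b ha hb v hv
    rw [add_dotProduct, ha v hv, hb v hv, add_zero]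
  zero_mem' := by
    intro v _
    exact zero_dotProduct v
  smul_mem' := by
    intro c a ha v hv
    rw [smul_dotProduct, ha v hv, smul_zero]

open Classical in
/-- The minimum distance of a block code: the least Hamming weight of a nonzero codeword
(`⊤` for the zero code). -/
noncomputable def minDist (C : Submodule F (Fin n → F)) : ℕ∞ :=
  ⨅ v : {v : Fin n → F // v ∈ C ∧ v ≠ 0}, (hammingNorm v.1 : ℕ∞)

/-! Polynomial generator matrices and convolutional codes.  The indeterminate `D` is `X`. -/

/-- The submodule `{u(D) G(D)}` of `F[D]^κ` generated by the rows of `G(D)`. -/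
noncomputable def rowModule {ι κ : Type*} [Fintype ι] (G : Matrix ι κ F[X]) : Submodule F[X] (κ → F[X]) :=
  LinearMap.range G.vecMulLinear

/-- The `i`-th constraint length: the largest degree of an entry in row `i`. -/
def constraintLength {ι κ : Type*} [Fintype κ] (G : Matrix ι κ F[X]) (i : ι) : ℕ :=
  Finset.univ.sup fun j => (G i j).natDegree

/-- The overall constraint length: the sum of the constraint lengths. -/
def overallConstraintLength {ι κ : Type*} [Fintype ι] [Fintype κ] (G : Matrix ι κ F[X]) : ℕ :=
  ∑ i, constraintLength G i

/-- The memory: the largest constraint length. -/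
def memory {ι κ : Type*} [Fintype ι] [Fintype κ] (G : Matrix ι κ F[X]) : ℕ :=
  Finset.univ.sup fun i => constraintLength G i

/-- `G(D)` is basic if it has a polynomial right inverse. -/
def IsBasic {ι κ : Type*} [DecidableEq ι] [Fintype κ] (G : Matrix ι κ F[X]) : Prop :=
  ∃ R : Matrix κ ι F[X], G * R = 1

/-- `G(D)` is reduced basic if it is basic and its overall constraint length is the smallest one
among all basic generator matrices of the same code.  That number is then the degree of the
code. -/
def IsReducedBasic {ι κ : Type*} [Fintype ι] [DecidableEq ι] [Fintype κ]
    (G : Matrix ι κ F[X]) : Prop :=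
  IsBasic G ∧ ∀ G' : Matrix ι κ F[X], IsBasic G' → rowModule G' = rowModule G →
    overallConstraintLength G ≤ overallConstraintLength G'

/-- `G(D)` is a reduced basic generator matrix of the convolutional code `V`. -/
def IsReducedBasicGenerator {ι κ : Type*} [Fintype ι] [DecidableEq ι] [Fintype κ]
    (G : Matrix ι κ F[X]) (V : Submodule F[X] (κ → F[X])) : Prop :=
  IsReducedBasic G ∧ rowModule G = V

/-- The weight of `v(D)`: the total number of nonzero coefficients of its components. -/
def weight (v : Fin n → F[X]) : ℕ :=
  ∑ j, (v j).support.card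

/-- The free distance of a convolutional code: the least weight of a nonzero codeword
(`⊤` for the zero code). -/
noncomputable def freeDist (V : Submodule F[X] (Fin n → F[X])) : ℕ∞ :=
  ⨅ v : {v : Fin n → F[X] // v ∈ V ∧ v ≠ 0}, (weight v.1 : ℕ∞)

/-- The Euclidean inner product `⟨u(D) | v(D)⟩ = ∑ t, u_t ⬝ v_t` of the coefficient
sequences. -/
def euclid (u v : Fin n → F[X]) : F :=
  ∑ j, ∑ t ∈ (u j).support, (u j).coeff t * (v j).coeff t

theorem euclid_add_left (u u' v : Fin n → F[X]) :
    euclid (u + u') v = euclid u v + euclid u' v := by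
  have h : ∀ u : Fin n → F[X],
      euclid u v = ∑ j, (u j).sum fun t a => a * (v j).coeff t := fun u => rfl
  rw [h, h, h, ← Finset.sum_add_distrib]
  refine Finset.sum_congr rfl fun j _ => ?_
  exact Polynomial.sum_add_index _ _ _ (fun t => zero_mul _) (fun t a b => add_mul _ _ _)

theorem euclid_zero_left (v : Fin n → F[X]) : euclid 0 v = 0 := by
  simp [euclid]

/-- The Euclidean dual of a convolutional code, as a convolutional code: the words `u(D)` all of
whose time shifts (equivalently: all of whose polynomial multiples) are Euclidean-orthogonal to
every codeword.  Equivalently `∑ j, u_j(D) v_j(1/D) = 0` for all codewords `v(D)`. -/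
def dual (V : Submodule F[X] (Fin n → F[X])) : Submodule F[X] (Fin n → F[X]) where
  carrier := {u | ∀ p : F[X], ∀ v ∈ V, euclid (p • u) v = 0}
  add_mem' := by
    intro a b ha hb p v hv
    rw [smul_add, euclid_add_left, ha p v hv, hb p v hv, add_zero]
  zero_mem' := by
    intro p v _
    rw [smul_zero, euclid_zero_left]
  smul_mem' := by
    intro c a ha p v hv
    rw [smul_smul]
    exact ha (p * c) v hv

/-! Quantum convolutional codes, described by their stabilizer matrices `S(D) = (X(D) | Z(D))`.

A Pauli operator on the stream of qudits which is the identity at all but finitely many places is,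
up to a phase, given by a pair `(a(D) | b(D))`: at place `j` of frame `t` it is `X(a)Z(b)` with `a`,
`b` the coefficients of `D ^ t` in the `j`-th components.  The stabilizer consists of the operators
in the row module of `S(D)`. -/

/-- The part of an operator `(a(D) | b(D))` made of qudit flips. -/
def xPart (e : Fin n ⊕ Fin n → F[X]) : Fin n → F[X] := fun j => e (Sum.inl j)

/-- The part of an operator `(a(D) | b(D))` made of phase shifts. -/
def zPart (e : Fin n ⊕ Fin n → F[X]) : Fin n → F[X] := fun j => e (Sum.inr j)

/-- The polynomial `p(D)` as a Laurent polynomial. -/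
noncomputable def atD (p : F[X]) : LaurentPolynomial F := Polynomial.toLaurent p

/-- The Laurent polynomial `p(1/D)`. -/
noncomputable def atInvD (p : F[X]) : LaurentPolynomial F :=
  LaurentPolynomial.invert (Polynomial.toLaurent p)

/-- Symplectic orthogonality `X(D) Z(1/D)ᵗ - Z(D) X(1/D)ᵗ = 0` of `S(D) = (X(D) | Z(D))`. -/
def IsSymplecticOrthogonal {ι : Type*} (S : Matrix ι (Fin n ⊕ Fin n) F[X]) : Prop :=
  S.toCols₁.map atD * (S.toCols₂.map atInvD).transpose
    - S.toCols₂.map atD * (S.toCols₁.map atInvD).transpose = 0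

/-- The symplectic form on operators. -/
def sympl (e s : Fin n ⊕ Fin n → F[X]) : F :=
  euclid (xPart e) (zPart s) - euclid (zPart e) (xPart s)

/-- The error `e` (at whatever time it occurs) commutes with every element of the stabilizer.
Two operators commute when the trace of their symplectic product vanishes; as the stabilizer is
closed under multiplication by scalars, this may be said without the trace. -/
def CommutesWithStabilizer {ι : Type*} [Fintype ι] (S : Matrix ι (Fin n ⊕ Fin n) F[X])
    (e : Fin n ⊕ Fin n → F[X]) : Prop :=
  ∀ p : F[X], ∀ s ∈ rowModule S, sympl (p • e) s = 0

/-- The error `e` cannot be detected: it commutes with the stabilizer without belonging to it. -/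
def Undetectable {ι : Type*} [Fintype ι] (S : Matrix ι (Fin n ⊕ Fin n) F[X])
    (e : Fin n ⊕ Fin n → F[X]) : Prop :=
  CommutesWithStabilizer S e ∧ e ∉ rowModule S

/-- The code has free distances `dz / dx` with respect to phase-shift / qudit-flip errors: every
error with fewer than `dx` qudit flips and fewer than `dz` phase shifts is detected, while some
error made of `dx` qudit flips, and some error made of `dz` phase shifts, is not. -/
def HasFreeDistances {ι : Type*} [Fintype ι] (S : Matrix ι (Fin n ⊕ Fin n) F[X])
    (dz dx : ℕ) : Prop :=
  (∀ e, weight (xPart e) < dx → weight (zPart e) < dz → ¬ Undetectable S e) ∧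
  (∃ e, Undetectable S e ∧ zPart e = 0 ∧ weight (xPart e) = dx) ∧
  (∃ e, Undetectable S e ∧ xPart e = 0 ∧ weight (zPart e) = dz)

/-- `S(D)` is a (reduced basic) stabilizer matrix of an asymmetric quantum convolutional code with
parameters `[(n, K, μ; γ, dz / dx)]`: it has `n - K` rows, it is symplectically orthogonal,
its memory is `μ` and its degree is `γ`. -/
structure IsAQCC {ι : Type*} [Fintype ι] [DecidableEq ι] (S : Matrix ι (Fin n ⊕ Fin n) F[X])
    (K μ γ dz dx : ℕ) : Prop where
  orthogonal : IsSymplecticOrthogonal S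
  reducedBasic : IsReducedBasic S
  rows : Fintype.card ι + K = n
  memory_eq : memory S = μ
  degree_eq : overallConstraintLength S = γ
  distances : HasFreeDistances S dz dx

/-- The CSS-type stabilizer matrix `( A(D) | 0 ; 0 | B(D) )`. -/
noncomputable def cssMatrix {ι κ : Type*} (A : Matrix ι (Fin n) F[X]) (B : Matrix κ (Fin n) F[X]) :
    Matrix (ι ⊕ κ) (Fin n ⊕ Fin n) F[X] :=
  Matrix.fromBlocks A 0 0 B

/-! The construction from blocks `H 0, H' 0, …, H μ, H' μ`, where all `H i` have `r` rows and
`H' i` has `s i` rows.  Only the indices `i ≤ μ` matter. -/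

/-- Zero rows are added at the bottom of `A` until it has `k` rows. -/
def padRows (k : ℕ) {a : ℕ} (A : Matrix (Fin a) (Fin n) F) : Matrix (Fin k) (Fin n) F :=
  fun i j => if h : (i : ℕ) < a then A ⟨i, h⟩ j else 0

/-- `A 0 + A 1 D + ⋯ + A μ D ^ μ`. -/
noncomputable def polyMatrix {ι : Type*} (μ : ℕ) (A : ℕ → Matrix ι (Fin n) F) :
    Matrix ι (Fin n) F[X] :=
  ∑ i ∈ Finset.range (μ + 1), (X : F[X]) ^ i • (A i).map C

variable {r : ℕ} {s : ℕ → ℕ}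

/-- The matrix whose rows are those of `H 0, H' 0, H 1, H' 1, …, H μ, H' μ`. -/
def fullMatrix (μ : ℕ) (H : ℕ → Matrix (Fin r) (Fin n) F)
    (H' : (i : ℕ) → Matrix (Fin (s i)) (Fin n) F) :
    Matrix ((i : Fin (μ + 1)) × (Fin r ⊕ Fin (s i))) (Fin n) F :=
  fun x => Matrix.fromRows (H x.1) (H' x.1) x.2

/-- The matrix whose rows are those of `H' 0, H' 1, …, H' μ`. -/
def starMatrix (μ : ℕ) (H' : (i : ℕ) → Matrix (Fin (s i)) (Fin n) F) :
    Matrix ((i : Fin (μ + 1)) × Fin (s i)) (Fin n) F :=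
  fun x => H' x.1 x.2

/-- `G₁(D) = [H 0 ; H' 0] + [H 1 ; H̃' 1] D + ⋯ + [H μ ; H̃' μ] D ^ μ`. -/
noncomputable def G₁ (μ : ℕ) (H : ℕ → Matrix (Fin r) (Fin n) F)
    (H' : (i : ℕ) → Matrix (Fin (s i)) (Fin n) F) : Matrix (Fin r ⊕ Fin (s 0)) (Fin n) F[X] :=
  polyMatrix μ fun i => Matrix.fromRows (H i) (padRows (s 0) (H' i))

/-- `G₂(D) = H' 0 + H̃' 1 D + ⋯ + H̃' μ D ^ μ`, the submatrix of the lower rows of `G₁(D)`. -/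
noncomputable def G₂ (μ : ℕ) (H' : (i : ℕ) → Matrix (Fin (s i)) (Fin n) F) :
    Matrix (Fin (s 0)) (Fin n) F[X] :=
  polyMatrix μ fun i => padRows (s 0) (H' i)

/-- The convolutional code `V₁` generated by `G₁(D)`. -/
noncomputable def V₁ (μ : ℕ) (H : ℕ → Matrix (Fin r) (Fin n) F)
    (H' : (i : ℕ) → Matrix (Fin (s i)) (Fin n) F) : Submodule F[X] (Fin n → F[X]) :=
  rowModule (G₁ μ H H')

/-- The convolutional code `V₂` generated by `G₂(D)`. -/
noncomputable def V₂ (μ : ℕ) (H' : (i : ℕ) → Matrix (Fin (s i)) (Fin n) F) :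
    Submodule F[X] (Fin n → F[X]) :=
  rowModule (G₂ μ H')

/-- `γ₂ = μ rk H'_μ + ∑ i = 1, …, μ - 1, (μ - i) (rk H'_(μ - i) - rk H'_(μ - i + 1))`. The ranks
decrease along the blocks, so that no subtraction is truncated. -/
noncomputable def γ₂ (μ : ℕ) (H' : (i : ℕ) → Matrix (Fin (s i)) (Fin n) F) : ℕ :=
  μ * (H' μ).rank +
    ∑ i ∈ Finset.Icc 1 (μ - 1), (μ - i) * ((H' (μ - i)).rank - (H' (μ - i + 1)).rank)

/-- `γ₁ = μ (rk H_μ + rk H'_μ) + ∑ i = 1, …, μ - 1, (μ - i) (rk H'_(μ - i) - rk H'_(μ - i + 1))`. -/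
noncomputable def γ₁ (μ : ℕ) (H : ℕ → Matrix (Fin r) (Fin n) F)
    (H' : (i : ℕ) → Matrix (Fin (s i)) (Fin n) F) : ℕ :=
  μ * ((H μ).rank + (H' μ).rank) +
    ∑ i ∈ Finset.Icc 1 (μ - 1), (μ - i) * ((H' (μ - i)).rank - (H' (μ - i + 1)).rank)

end AQCC

open AQCC

namespace AQCC

variable {F : Type*} [Field F] {n : ℕ}

/-! ### Row modules -/

/-! The given vectors complete to a basis `p` of the space of words, with a dual basis `q`. Because
the ranks of the blocks `H' i` decrease, row `i` of `G₁` has nonzero coefficient vectors exactly at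
`D ^ 0, …, D ^ d i`, and no given vector is used twice: the row is `∑ D ^ l p_(i, l)`, a
"staircase". The lower rows give `G₂` in the same way.

The structural claims are read off in these bases. The leading vectors `p_(i, d i)` are independent,
so degrees in the row module are predictable and `∑ d i` is the least overall constraint length
(`IsRowReduced.isReducedBasic`); the vectors `q_(i, 0)` give a polynomial right inverse. The words
`D q_(i, l + 1) - q_(i, l)` cancel against row `i`; together with the `q_k` dual to the added basis
vectors they generate the whole dual (`dual_stairGen`). They too are row reduced and basic, with `∑
d i` rows of degree one and the others constant, so the dual of `V₁` has degree `γ₁`, and its own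
dual is `V₁` again (`dual_stairDual`).

For the distances, every coefficient vector of a word of `V₁` is a combination of the given vectors.
In a word of the dual of `V₂` the last nonzero coefficient vector is orthogonal to `H' 0` and the
first to the padded `H' μ`; if they coincide, that vector is orthogonal to all blocks
(`min_minDist_le_freeDist_dual`). Constant words give the upper bound.

The quantum code is of CSS type: an error commutes with the stabilizer when its flip part lies in
`V₁` and its shift part in the dual of `V₂`, and membership in the stabilizer splits likewise, so
the distances are those of `V₁ \ V₂` and of the difference of the duals. -/

theorem mem_rowModule {ι κ : Type*} [Fintype ι] {G : Matrix ι κ F[X]} {v : κ → F[X]} :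
    v ∈ rowModule G ↔ ∃ u : ι → F[X], Matrix.vecMul u G = v := Iff.rfl

theorem row_mem_rowModule {ι κ : Type*} [Fintype ι] [DecidableEq ι] (G : Matrix ι κ F[X]) (i : ι) :
    G i ∈ rowModule G := ⟨Pi.single i 1, by simp [Matrix.row]⟩

theorem rowModule_le_iff {ι κ : Type*} [Fintype ι] [DecidableEq ι] {G : Matrix ι κ F[X]}
    {V : Submodule F[X] (κ → F[X])} : rowModule G ≤ V ↔ ∀ i, G i ∈ V := by
  refine ⟨fun h i => h (row_mem_rowModule G i), ?_⟩
  rintro h _ ⟨u, rfl⟩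
  have : G.vecMulLinear u = ∑ i, u i • G i := by
    ext1 j
    simp [Matrix.vecMul, dotProduct]
  rw [this]
  exact Submodule.sum_mem _ fun i _ => V.smul_mem _ (h i)

theorem rowModule_reindex {ι ι' κ : Type*} [Fintype ι] [Fintype ι'] [DecidableEq ι]
    [DecidableEq ι'] (G : Matrix ι κ F[X]) (e : ι' ≃ ι) :
    rowModule (G.submatrix e id) = rowModule G := by
  apply le_antisymm
  · exact rowModule_le_iff.2 fun i => row_mem_rowModule G (e i)
  · refine rowModule_le_iff.2 fun i => ?_
    have := row_mem_rowModule (G.submatrix e id) (e.symm i)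
    convert this using 1
    ext1 j
    simp

/-! ### Reduced basic matrices -/

/-- The rows of each matrix are combinations of the rows of the other, so `G' = T * S * G'`; the
right inverse of `G'` cancels it and leaves `T * S = 1`. -/
theorem IsBasic.exists_det_ne_zero_mul_eq {ι κ : Type*} [Fintype ι] [DecidableEq ι] [Fintype κ]
    {G G' : Matrix ι κ F[X]} (hG' : IsBasic G') (h : rowModule G' = rowModule G) :
    ∃ T : Matrix ι ι F[X], T.det ≠ 0 ∧ T * G = G' := by
  obtain ⟨R, hR⟩ := hG'
  have h1 : ∀ i, ∃ u : ι → F[X], Matrix.vecMul u G = G' i := fun i => by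
    rw [← mem_rowModule, ← h]; exact row_mem_rowModule _ _
  have h2 : ∀ i, ∃ u : ι → F[X], Matrix.vecMul u G' = G i := fun i => by
    rw [← mem_rowModule, h]; exact row_mem_rowModule _ _
  choose T hT using h1
  choose S hS using h2
  have hT' : (Matrix.of T) * G = G' := by
    funext i
    exact hT i
  have hS' : (Matrix.of S) * G' = G := by
    funext i
    exact hS i
  refine ⟨Matrix.of T, ?_, hT'⟩
  have h3 : Matrix.of T * Matrix.of S = 1 := by
    rw [← hR]
    conv_rhs => rw [← hT', ← hS', ← Matrix.mul_assoc]
    rw [Matrix.mul_assoc, hR, Matrix.mul_one]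
  intro h0
  have := congrArg Matrix.det h3
  rw [Matrix.det_mul, h0, zero_mul, Matrix.det_one] at this
  exact zero_ne_one this

/-- The entries of row `i` have degree at most `d i`, and the matrix of the coefficients of
`D ^ d i` has a right inverse. -/
def IsRowReduced {ι κ : Type*} [DecidableEq ι] [Fintype κ] (G : Matrix ι κ F[X])
    (d : ι → ℕ) : Prop :=
  (∀ i j, (G i j).natDegree ≤ d i) ∧
    ∃ M : Matrix κ ι F, (Matrix.of fun i j => (G i j).coeff (d i)) * M = 1

theorem IsRowReduced.constraintLength_eq {ι κ : Type*} [DecidableEq ι] [Fintype κ]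
    {G : Matrix ι κ F[X]} {d : ι → ℕ} (h : IsRowReduced G d) (i : ι) :
    constraintLength G i = d i := by
  obtain ⟨hd, M, hM⟩ := h
  refine le_antisymm (Finset.sup_le fun j _ => hd i j) ?_
  have h1 : ∃ j, (G i j).coeff (d i) ≠ 0 := by
    by_contra! h0
    have := congrFun (congrFun hM i) i
    simp [Matrix.mul_apply, h0] at this
  obtain ⟨j, hj⟩ := h1
  exact (le_natDegree_of_ne_zero hj).trans
    (Finset.le_sup (f := fun j => (G i j).natDegree) (Finset.mem_univ j))

/-- The predictable degree property. -/
theorem IsRowReduced.exists_le_natDegree {ι κ : Type*} [Fintype ι] [DecidableEq ι] [Fintype κ]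
    {G : Matrix ι κ F[X]} {d : ι → ℕ} (h : IsRowReduced G d) (u : ι → F[X]) (i : ι)
    (hi : u i ≠ 0) : ∃ j, d i ≤ (Matrix.vecMul u G j).natDegree := by
  obtain ⟨hd, M, hM⟩ := h
  classical
  obtain ⟨k, hk, hmax⟩ := Finset.exists_max_image (Finset.univ.filter fun i => u i ≠ 0)
    (fun i => (u i).natDegree + d i) ⟨i, by simpa using hi⟩
  simp only [Finset.mem_filter, Finset.mem_univ, true_and] at hk hmax
  -- `N` is the largest degree that a term `u l * G l j` can reach; at `D ^ N` only the leading
  -- coefficient matrix of `G` contributes.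
  set N := (u k).natDegree + d k with hN
  by_contra! hlt
  have hlt' : ∀ j, (Matrix.vecMul u G j).coeff N = 0 := fun j =>
    coeff_eq_zero_of_natDegree_lt ((hlt j).trans_le
      ((Nat.le_add_left _ _).trans (hmax i hi)))
  -- This is the coefficient of `D ^ (N - d i)` in `u i`, read as zero when `N < d i`, so that no
  -- subtraction is truncated.
  set c : ι → F := fun i => (u i * X ^ d i).coeff N with hc
  have h1 : ∀ j, ∑ i, c i * (G i j).coeff (d i) = 0 := by
    intro j
    rw [← hlt' j]
    simp only [Matrix.vecMul, dotProduct, finsetSum_coeff]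
    refine Finset.sum_congr rfl fun l _ => ?_
    by_cases hl : u l = 0
    · simp [hc, hl]
    · obtain ⟨m, hm⟩ := Nat.exists_eq_add_of_le (hmax l hl)
      have h2 : N = ((u l).natDegree + m) + d l := by omega
      rw [h2, coeff_mul_add_eq_of_natDegree_le (by omega) (hd l j)]
      simp only [hc]
      rw [h2, coeff_mul_X_pow]
  have h2 : Matrix.vecMul c (Matrix.of fun i j => (G i j).coeff (d i)) = 0 := by
    ext1 j
    simpa [Matrix.vecMul, dotProduct] using h1 j
  have h3 : c = 0 := by
    rw [← Matrix.vecMul_one c, ← hM, ← Matrix.vecMul_vecMul, h2, Matrix.zero_vecMul]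
  have h4 := congrFun h3 k
  simp only [hc, hN, coeff_mul_X_pow, Pi.zero_apply, coeff_natDegree, leadingCoeff_eq_zero] at h4
  exact hk h4

theorem IsRowReduced.overallConstraintLength_eq {ι κ : Type*} [Fintype ι] [DecidableEq ι]
    [Fintype κ] {G : Matrix ι κ F[X]} {d : ι → ℕ} (h : IsRowReduced G d) :
    overallConstraintLength G = ∑ i, d i :=
  Finset.sum_congr rfl fun i _ => h.constraintLength_eq i

theorem IsRowReduced.isReducedBasic {ι κ : Type*} [Fintype ι] [DecidableEq ι] [Fintype κ]
    {G : Matrix ι κ F[X]} {d : ι → ℕ} (h : IsRowReduced G d) (hb : IsBasic G) :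
    IsReducedBasic G := by
  refine ⟨hb, fun G' hG' hr => ?_⟩
  obtain ⟨T, hT, rfl⟩ := hG'.exists_det_ne_zero_mul_eq hr
  -- A nonzero Leibniz term of the determinant is a permutation for which row `σ i` of `T * G`
  -- really involves row `i` of `G`; by the predictable degree property its constraint length is
  -- then at least `d i`.
  rw [Matrix.det_apply] at hT
  obtain ⟨σ, -, hσ⟩ := Finset.exists_ne_zero_of_sum_ne_zero hT
  have hσ' : ∀ i, T (σ i) i ≠ 0 := fun i h0 => hσ (by
    rw [Finset.prod_eq_zero (f := fun i => T (σ i) i) (Finset.mem_univ i) h0, smul_zero])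
  rw [h.overallConstraintLength_eq, overallConstraintLength,
    ← Equiv.sum_comp σ (constraintLength (T * G))]
  refine Finset.sum_le_sum fun i _ => ?_
  obtain ⟨j, hj⟩ := h.exists_le_natDegree (T (σ i)) i (hσ' i)
  exact hj.trans (Finset.le_sup (f := fun j => ((T * G) (σ i) j).natDegree) (Finset.mem_univ j))

theorem IsReducedBasic.overallConstraintLength_eq {ι κ : Type*} [Fintype ι] [DecidableEq ι]
    [Fintype κ] {G G' : Matrix ι κ F[X]} (h : IsReducedBasic G) (h' : IsReducedBasic G')
    (hr : rowModule G = rowModule G') :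
    overallConstraintLength G = overallConstraintLength G' :=
  le_antisymm (h.2 _ h'.1 hr.symm) (h'.2 _ h.1 hr)

theorem IsBasic.submatrix {ι ι' κ : Type*} [DecidableEq ι] [DecidableEq ι'] [Fintype κ]
    {G : Matrix ι κ F[X]} (h : IsBasic G) {e : ι' → ι} (he : Function.Injective e) :
    IsBasic (G.submatrix e id) := by
  obtain ⟨R, hR⟩ := h
  refine ⟨R.submatrix id e, ?_⟩
  rw [← Matrix.submatrix_mul _ _ e id e Function.bijective_id, hR, Matrix.submatrix_one e he]

theorem IsRowReduced.submatrix {ι ι' κ : Type*} [DecidableEq ι] [DecidableEq ι'] [Fintype κ]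
    {G : Matrix ι κ F[X]} {d : ι → ℕ} (h : IsRowReduced G d) {e : ι' → ι}
    (he : Function.Injective e) : IsRowReduced (G.submatrix e id) (d ∘ e) := by
  obtain ⟨hd, M, hM⟩ := h
  refine ⟨fun i j => hd _ _, M.submatrix id e, ?_⟩
  rw [← Matrix.submatrix_one e he, ← hM, Matrix.submatrix_mul _ _ e id e Function.bijective_id]
  rfl

/-! ### The CSS matrix -/

theorem IsBasic.cssMatrix {ι κ : Type*} [DecidableEq ι] [DecidableEq κ]
    {A : Matrix ι (Fin n) F[X]} {B : Matrix κ (Fin n) F[X]} (hA : IsBasic A) (hB : IsBasic B) :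
    IsBasic (cssMatrix A B) := by
  obtain ⟨R, hR⟩ := hA
  obtain ⟨S, hS⟩ := hB
  refine ⟨Matrix.fromBlocks R 0 0 S, ?_⟩
  simp [AQCC.cssMatrix, Matrix.fromBlocks_multiply, hR, hS]

theorem IsRowReduced.cssMatrix {ι κ : Type*} [DecidableEq ι] [DecidableEq κ]
    {A : Matrix ι (Fin n) F[X]} {B : Matrix κ (Fin n) F[X]} {d : ι → ℕ} {d' : κ → ℕ}
    (hA : IsRowReduced A d) (hB : IsRowReduced B d') :
    IsRowReduced (cssMatrix A B) (Sum.elim d d') := by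
  obtain ⟨hd, M, hM⟩ := hA
  obtain ⟨hd', M', hM'⟩ := hB
  refine ⟨?_, Matrix.fromBlocks M 0 0 M', ?_⟩
  · rintro (i | i) (j | j) <;> simp [AQCC.cssMatrix, hd, hd']
  · have : (Matrix.of fun i j => ((AQCC.cssMatrix A B) i j).coeff (Sum.elim d d' i)) =
        Matrix.fromBlocks (Matrix.of fun i j => (A i j).coeff (d i)) 0 0
          (Matrix.of fun i j => (B i j).coeff (d' i)) := by
      ext (i | i) (j | j) <;> simp [AQCC.cssMatrix]
    rw [this, Matrix.fromBlocks_multiply]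
    simp [hM, hM']

theorem constraintLength_cssMatrix_inl {ι κ : Type*}
    (A : Matrix ι (Fin n) F[X]) (B : Matrix κ (Fin n) F[X]) (i : ι) :
    constraintLength (cssMatrix A B) (Sum.inl i) = constraintLength A i := by
  apply le_antisymm
  · refine Finset.sup_le fun j _ => ?_
    rcases j with j | j
    · exact Finset.le_sup (f := fun j => (A i j).natDegree) (Finset.mem_univ j)
    · simp [cssMatrix]
  · exact Finset.sup_le fun j _ => Finset.le_sup
      (f := fun j => (cssMatrix A B (Sum.inl i) j).natDegree) (Finset.mem_univ (Sum.inl j))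

theorem constraintLength_cssMatrix_inr {ι κ : Type*}
    (A : Matrix ι (Fin n) F[X]) (B : Matrix κ (Fin n) F[X]) (i : κ) :
    constraintLength (cssMatrix A B) (Sum.inr i) = constraintLength B i := by
  apply le_antisymm
  · refine Finset.sup_le fun j _ => ?_
    rcases j with j | j
    · simp [cssMatrix]
    · exact Finset.le_sup (f := fun j => (B i j).natDegree) (Finset.mem_univ j)
  · exact Finset.sup_le fun j _ => Finset.le_sup
      (f := fun j => (cssMatrix A B (Sum.inr i) j).natDegree) (Finset.mem_univ (Sum.inr j))

theorem overallConstraintLength_cssMatrix {ι κ : Type*} [Fintype ι] [Fintype κ]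
    (A : Matrix ι (Fin n) F[X]) (B : Matrix κ (Fin n) F[X]) :
    overallConstraintLength (cssMatrix A B) =
      overallConstraintLength A + overallConstraintLength B := by
  simp [overallConstraintLength, Fintype.sum_sum_type, constraintLength_cssMatrix_inl,
    constraintLength_cssMatrix_inr]

theorem memory_cssMatrix {ι κ : Type*} [Fintype ι] [Fintype κ]
    (A : Matrix ι (Fin n) F[X]) (B : Matrix κ (Fin n) F[X]) :
    memory (cssMatrix A B) = max (memory A) (memory B) := by
  apply le_antisymm
  · refine Finset.sup_le fun i _ => ?_
    rcases i with i | i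
    · rw [constraintLength_cssMatrix_inl]
      exact le_max_of_le_left (Finset.le_sup (f := constraintLength A) (Finset.mem_univ i))
    · rw [constraintLength_cssMatrix_inr]
      exact le_max_of_le_right (Finset.le_sup (f := constraintLength B) (Finset.mem_univ i))
  · refine max_le (Finset.sup_le fun i _ => ?_) (Finset.sup_le fun i _ => ?_)
    · rw [← constraintLength_cssMatrix_inl A B]
      exact Finset.le_sup (f := constraintLength (cssMatrix A B)) (Finset.mem_univ _)
    · rw [← constraintLength_cssMatrix_inr A B]
      exact Finset.le_sup (f := constraintLength (cssMatrix A B)) (Finset.mem_univ _)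

theorem mem_rowModule_cssMatrix {ι κ : Type*} [Fintype ι] [Fintype κ]
    {A : Matrix ι (Fin n) F[X]} {B : Matrix κ (Fin n) F[X]} {e : Fin n ⊕ Fin n → F[X]} :
    e ∈ rowModule (cssMatrix A B) ↔ xPart e ∈ rowModule A ∧ zPart e ∈ rowModule B := by
  constructor
  · rintro ⟨u, rfl⟩
    refine ⟨⟨fun i => u (Sum.inl i), ?_⟩, ⟨fun i => u (Sum.inr i), ?_⟩⟩ <;>
    · ext1 j
      simp [xPart, zPart, cssMatrix, Matrix.vecMul, dotProduct, Fintype.sum_sum_type]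
  · rintro ⟨⟨a, ha⟩, ⟨b, hb⟩⟩
    refine ⟨Sum.elim a b, ?_⟩
    ext1 j
    rcases j with j | j
    · have := congrFun ha j
      simpa [xPart, cssMatrix, Matrix.vecMul, dotProduct, Fintype.sum_sum_type] using this
    · have := congrFun hb j
      simpa [zPart, cssMatrix, Matrix.vecMul, dotProduct, Fintype.sum_sum_type] using this

theorem rowModule_cssMatrix_congr {ι κ ι' κ' : Type*} [Fintype ι] [Fintype κ] [Fintype ι']
    [Fintype κ'] {A : Matrix ι (Fin n) F[X]} {B : Matrix κ (Fin n) F[X]}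
    {A' : Matrix ι' (Fin n) F[X]} {B' : Matrix κ' (Fin n) F[X]}
    (hA : rowModule A = rowModule A') (hB : rowModule B = rowModule B') :
    rowModule (cssMatrix A B) = rowModule (cssMatrix A' B') := by
  ext e
  rw [mem_rowModule_cssMatrix, mem_rowModule_cssMatrix, hA, hB]

/-! ### The Laurent inner product and the dual -/

/-- `∑ j, u_j(D) v_j(1/D)`. -/
noncomputable def lprod (u v : Fin n → F[X]) : LaurentPolynomial F :=
  ∑ j, atD (u j) * atInvD (v j)

theorem lprod_add_left (u u' v : Fin n → F[X]) : lprod (u + u') v = lprod u v + lprod u' v := by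
  simp [lprod, atD, add_mul, Finset.sum_add_distrib]

theorem lprod_sub_left (u u' v : Fin n → F[X]) : lprod (u - u') v = lprod u v - lprod u' v := by
  simp [lprod, atD, sub_mul, Finset.sum_sub_distrib]

theorem lprod_smul_left (p : F[X]) (u v : Fin n → F[X]) :
    lprod (p • u) v = atD p * lprod u v := by
  simp [lprod, atD, Finset.mul_sum, mul_assoc]

theorem lprod_comm (u v : Fin n → F[X]) : lprod v u = LaurentPolynomial.invert (lprod u v) := by
  simp only [lprod, map_sum, map_mul, atD, atInvD]
  refine Finset.sum_congr rfl fun j _ => ?_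
  rw [LaurentPolynomial.involutive_invert, mul_comm]

theorem lprod_smul_right (p : F[X]) (u v : Fin n → F[X]) :
    lprod u (p • v) = atInvD p * lprod u v := by
  rw [lprod_comm, lprod_smul_left, map_mul, ← lprod_comm]; rfl

theorem lprod_add_right (u v v' : Fin n → F[X]) : lprod u (v + v') = lprod u v + lprod u v' := by
  rw [lprod_comm, lprod_add_left, map_add, ← lprod_comm, ← lprod_comm]

theorem lprod_sum_right {ι : Type*} (s : Finset ι) (u : Fin n → F[X]) (f : ι → Fin n → F[X]) :
    lprod u (∑ i ∈ s, f i) = ∑ i ∈ s, lprod u (f i) :=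
  map_sum (AddMonoidHom.mk' (fun v => lprod u v) fun a b => lprod_add_right u a b) f s

theorem coeff_T_mul (k m : ℤ) (f : LaurentPolynomial F) :
    (LaurentPolynomial.T k * f).coeff m = f.coeff (m - k) := by
  rw [LaurentPolynomial.T, AddMonoidAlgebra.coeff_single_mul_apply, one_mul, neg_add_eq_sub]

theorem coeff_toLaurent_natCast (p : F[X]) (k : ℕ) : (toLaurent p).coeff (k : ℤ) = p.coeff k := by
  rw [LaurentPolynomial.coeff_toLaurent]
  exact Finsupp.mapDomain_apply Nat.castEmbedding.injective _ _

theorem coeff_zero_atD_mul_atInvD (p q : F[X]) :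
    (atD p * atInvD q).coeff 0 = p.sum fun t a => a * q.coeff t := by
  induction p using Polynomial.induction_on' with
  | add p p' h h' =>
    rw [Polynomial.sum_add_index _ _ _ (fun t => zero_mul _) (fun t a b => add_mul _ _ _), ← h,
      ← h', atD, map_add, add_mul]
    rfl
  | monomial k a =>
    rw [Polynomial.sum_monomial_index (f := fun t a => a * q.coeff t) a (zero_mul _), atD, toLaurent_C_mul_T, mul_assoc,
      ← LaurentPolynomial.smul_eq_C_mul, AddMonoidAlgebra.coeff_smul, Finsupp.smul_apply,
      coeff_T_mul, atInvD, LaurentPolynomial.invert_apply, zero_sub, neg_neg,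
      coeff_toLaurent_natCast, smul_eq_mul]

theorem euclid_eq_coeff_lprod (u v : Fin n → F[X]) : euclid u v = (lprod u v).coeff 0 := by
  rw [lprod, AddMonoidAlgebra.coeff_sum, Finsupp.finsetSum_apply]
  exact Finset.sum_congr rfl fun j _ => (coeff_zero_atD_mul_atInvD _ _).symm

/-- Each coefficient of the Laurent product is a Euclidean product of shifts: nonnegative exponents
come from shifting `v`, nonpositive ones from shifting `u`. -/
theorem mem_dual_iff {V : Submodule F[X] (Fin n → F[X])} {u : Fin n → F[X]} :
    u ∈ dual V ↔ ∀ v ∈ V, lprod u v = 0 := by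
  constructor
  · intro h v hv
    apply LaurentPolynomial.ext
    intro m
    rcases le_total 0 m with hm | hm
    · obtain ⟨k, rfl⟩ := Int.eq_ofNat_of_zero_le hm
      have := h 1 ((X : F[X]) ^ k • v) (V.smul_mem _ hv)
      rw [one_smul, euclid_eq_coeff_lprod, lprod_smul_right, atInvD, toLaurent_X_pow,
        LaurentPolynomial.invert_T, coeff_T_mul] at this
      simpa using this
    · obtain ⟨k, hk⟩ := Int.eq_ofNat_of_zero_le (neg_nonneg.2 hm)
      have := h ((X : F[X]) ^ k) v hv
      rw [euclid_eq_coeff_lprod, lprod_smul_left, atD, toLaurent_X_pow, coeff_T_mul, ← hk] at this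
      simpa using this
  · intro h p v hv
    rw [euclid_eq_coeff_lprod, lprod_smul_left, h v hv, mul_zero]
    rfl

theorem mem_dual_rowModule {ι : Type*} [Fintype ι] [DecidableEq ι] {G : Matrix ι (Fin n) F[X]}
    {u : Fin n → F[X]} : u ∈ dual (rowModule G) ↔ ∀ i, lprod u (G i) = 0 := by
  rw [mem_dual_iff]
  refine ⟨fun h i => h _ (row_mem_rowModule G i), ?_⟩
  rintro h _ ⟨c, rfl⟩
  have : G.vecMulLinear c = ∑ i, c i • G i := by
    ext1 j
    simp [Matrix.vecMul, dotProduct]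
  rw [this, lprod_sum_right]
  exact Finset.sum_eq_zero fun i _ => by rw [lprod_smul_right, h, mul_zero]

theorem le_dual_dual (V : Submodule F[X] (Fin n → F[X])) : V ≤ dual (dual V) := by
  intro v hv
  rw [mem_dual_iff]
  intro u hu
  rw [lprod_comm, mem_dual_iff.1 hu v hv, map_zero]

theorem dual_anti {V W : Submodule F[X] (Fin n → F[X])} (h : V ≤ W) : dual W ≤ dual V :=
  fun _ hu p v hv => hu p v (h hv)

theorem euclid_zero_right (u : Fin n → F[X]) : euclid u 0 = 0 := by simp [euclid]

/-! ### Detectability for CSS matrices -/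

/-- The stabilizer contains the operators `(0 | v)` and `(v | 0)` separately, and these test the
flip part and the shift part independently. -/
theorem commutesWithStabilizer_cssMatrix {ι κ : Type*} [Fintype ι] [Fintype κ]
    {A : Matrix ι (Fin n) F[X]} {B : Matrix κ (Fin n) F[X]} {e : Fin n ⊕ Fin n → F[X]} :
    CommutesWithStabilizer (cssMatrix A B) e ↔
      xPart e ∈ dual (rowModule B) ∧ zPart e ∈ dual (rowModule A) := by
  have hx : ∀ p : F[X], xPart (p • e) = p • xPart e := fun p => rfl
  have hz : ∀ p : F[X], zPart (p • e) = p • zPart e := fun p => rfl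
  constructor
  · intro h
    refine ⟨fun p v hv => ?_, fun p v hv => ?_⟩
    · have := h p (Sum.elim 0 v) (mem_rowModule_cssMatrix.2 ⟨zero_mem _, hv⟩)
      have hx' : xPart (Sum.elim (0 : Fin n → F[X]) v) = 0 := rfl
      have hz' : zPart (Sum.elim (0 : Fin n → F[X]) v) = v := rfl
      rwa [sympl, hx', hz', euclid_zero_right, sub_zero] at this
    · have := h p (Sum.elim v 0) (mem_rowModule_cssMatrix.2 ⟨hv, zero_mem _⟩)
      have hx' : xPart (Sum.elim v (0 : Fin n → F[X])) = v := rfl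
      have hz' : zPart (Sum.elim v (0 : Fin n → F[X])) = 0 := rfl
      rwa [sympl, hx', hz', euclid_zero_right, zero_sub, neg_eq_zero] at this
  · rintro ⟨h1, h2⟩ p s hs
    rw [mem_rowModule_cssMatrix] at hs
    rw [sympl, hx, hz, h1 p _ hs.2, h2 p _ hs.1, sub_zero]

/-- An undetectable error fails to be a stabilizer element in its flip part or in its shift part,
and that part alone already has the corresponding least weight. -/
theorem hasFreeDistances_cssMatrix {ι κ : Type*} [Fintype ι] [Fintype κ]
    {A : Matrix ι (Fin n) F[X]} {B : Matrix κ (Fin n) F[X]} {dz dx : ℕ}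
    (hx : IsLeast (weight '' ((dual (rowModule B) : Set (Fin n → F[X])) \ rowModule A)) dx)
    (hz : IsLeast (weight '' ((dual (rowModule A) : Set (Fin n → F[X])) \ rowModule B)) dz) :
    HasFreeDistances (cssMatrix A B) dz dx := by
  refine ⟨?_, ?_, ?_⟩
  · rintro e h1 h2 ⟨hc, he⟩
    rw [commutesWithStabilizer_cssMatrix] at hc
    rw [mem_rowModule_cssMatrix, not_and_or] at he
    rcases he with he | he
    · exact absurd (hx.2 ⟨_, ⟨hc.1, he⟩, rfl⟩) (not_le.2 h1)
    · exact absurd (hz.2 ⟨_, ⟨hc.2, he⟩, rfl⟩) (not_le.2 h2)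
  · obtain ⟨v, ⟨hv, hv'⟩, hw⟩ := hx.1
    exact ⟨Sum.elim v 0, ⟨commutesWithStabilizer_cssMatrix.2 ⟨hv, zero_mem _⟩,
      fun h => hv' (mem_rowModule_cssMatrix.1 h).1⟩, rfl, hw⟩
  · obtain ⟨v, ⟨hv, hv'⟩, hw⟩ := hz.1
    exact ⟨Sum.elim 0 v, ⟨commutesWithStabilizer_cssMatrix.2 ⟨zero_mem _, hv⟩,
      fun h => hv' (mem_rowModule_cssMatrix.1 h).2⟩, rfl, hw⟩

theorem isSymplecticOrthogonal_cssMatrix {ι κ : Type*}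
    {A : Matrix ι (Fin n) F[X]} {B : Matrix κ (Fin n) F[X]}
    (h : ∀ i k, lprod (B k) (A i) = 0) : IsSymplecticOrthogonal (cssMatrix A B) := by
  have h' : ∀ i k, lprod (A i) (B k) = 0 := fun i k => by rw [lprod_comm, h, map_zero]
  refine Matrix.ext ?_
  rintro (i | i) (j | j)
  · simp [cssMatrix, Matrix.mul_apply, atD, atInvD]
  · simpa [cssMatrix, Matrix.mul_apply, atD, atInvD, lprod] using h' i j
  · simpa [cssMatrix, Matrix.mul_apply, atD, atInvD, lprod] using h j i
  · simp [cssMatrix, Matrix.mul_apply, atD, atInvD]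

/-! ### Dual bases -/

/-- The families `p` and `q` are dual bases of `F ^ n`. -/
structure IsDualPair {B : Type*} [Fintype B] [DecidableEq B] (p q : B → Fin n → F) : Prop where
  dot : ∀ a b, p a ⬝ᵥ q b = if a = b then 1 else 0
  expand : ∀ j k, ∑ b, p b j * q b k = if j = k then 1 else 0

theorem IsDualPair.symm {B : Type*} [Fintype B] [DecidableEq B] {p q : B → Fin n → F}
    (h : IsDualPair p q) : IsDualPair q p where
  dot a b := by rw [dotProduct_comm, h.dot]; simp [eq_comm]
  expand j k := by
    have := h.expand k j
    simp only [mul_comm (q _ _), this, eq_comm]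

theorem exists_isDualPair {A : Type*} [Fintype A] [DecidableEq A] {v : A → Fin n → F}
    (hv : LinearIndependent F v) :
    ∃ m : ℕ, Fintype.card A + m = n ∧ ∃ p q : A ⊕ Fin m → Fin n → F,
      IsDualPair p q ∧ ∀ a, p (Sum.inl a) = v a := by
  classical
  let b := Module.Basis.sumExtend hv
  have hfin : Finite (A ⊕ Module.Basis.sumExtendIndex hv) := Module.Finite.finite_basis b
  have : Finite (Module.Basis.sumExtendIndex hv) :=
    Finite.of_injective (Sum.inr : _ → A ⊕ Module.Basis.sumExtendIndex hv) Sum.inr_injective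
  obtain ⟨m, ⟨e⟩⟩ := Finite.exists_equiv_fin (Module.Basis.sumExtendIndex hv)
  let c := b.reindex (Equiv.sumCongr (Equiv.refl A) e)
  -- The dual basis consists of the coordinate functionals of the completed basis, evaluated on the
  -- standard basis.
  refine ⟨m, ?_, c, fun a j => c.repr (Pi.single j 1) a, ⟨?_, ?_⟩, ?_⟩
  · have := Module.finrank_eq_card_basis c
    simpa using this.symm
  · intro a a'
    have h1 : c a = ∑ j, c a j • (Pi.single j 1 : Fin n → F) := by
      simpa using pi_eq_sum_univ' (c a)
    have h2 : c.repr (c a) a' = if a = a' then 1 else 0 := by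
      rw [c.repr_self, Finsupp.single_apply]
    rw [← h2]
    conv_rhs => rw [h1]
    simp [dotProduct, Finsupp.finsetSum_apply]
  · intro j k
    have := congrFun (c.sum_repr (Pi.single k 1)) j
    simp only [Finset.sum_apply, Pi.smul_apply, smul_eq_mul, Pi.single_apply] at this
    rw [← this]
    exact Finset.sum_congr rfl fun _ _ => mul_comm _ _
  · intro a
    simp only [c, b, Module.Basis.reindex_apply]
    simp only [Module.Basis.sumExtend, Module.Basis.reindex_apply, Module.Basis.extend_apply_self]
    rfl

/-! ### Constant words -/

/-- The constant word with value `c`. -/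
noncomputable def constWord (c : Fin n → F) : Fin n → F[X] := fun j => C (c j)

/-- The polynomial `∑ j, c_j u_j(D)`. -/
noncomputable def coordinate (c : Fin n → F) (u : Fin n → F[X]) : F[X] := ∑ j, C (c j) * u j

theorem lprod_constWord_right (u : Fin n → F[X]) (c : Fin n → F) :
    lprod u (constWord c) = atD (coordinate c u) := by
  simp only [lprod, constWord, coordinate, atD, atInvD, map_sum, map_mul, toLaurent_C,
    LaurentPolynomial.invert_C]
  exact Finset.sum_congr rfl fun j _ => mul_comm _ _

theorem coordinate_constWord (c c' : Fin n → F) :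
    coordinate c (constWord c') = C (c ⬝ᵥ c') := by
  simp [coordinate, constWord, dotProduct]

theorem coordinate_add (c : Fin n → F) (u v : Fin n → F[X]) :
    coordinate c (u + v) = coordinate c u + coordinate c v := by
  simp [coordinate, mul_add, Finset.sum_add_distrib]

theorem coordinate_smul (c : Fin n → F) (a : F[X]) (u : Fin n → F[X]) :
    coordinate c (a • u) = a * coordinate c u := by
  simp only [coordinate, Pi.smul_apply, smul_eq_mul, Finset.mul_sum]
  exact Finset.sum_congr rfl fun j _ => by ring

theorem coordinate_sum {A : Type*} (s : Finset A) (c : Fin n → F) (f : A → Fin n → F[X]) :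
    coordinate c (∑ a ∈ s, f a) = ∑ a ∈ s, coordinate c (f a) :=
  map_sum (AddMonoidHom.mk' (coordinate c) (coordinate_add c)) f s

theorem IsDualPair.sum_coordinate {B : Type*} [Fintype B] [DecidableEq B] {p q : B → Fin n → F}
    (h : IsDualPair p q) (u : Fin n → F[X]) :
    ∑ b, coordinate (p b) u • constWord (q b) = u := by
  ext1 k
  simp only [coordinate, constWord, Finset.sum_apply, Pi.smul_apply, smul_eq_mul, Finset.sum_mul]
  rw [Finset.sum_comm]
  have : ∀ j, ∑ b, C (p b j) * u j * C (q b k) = if j = k then u j else 0 := fun j => by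
    have h1 : ∑ b, C (p b j) * u j * C (q b k) = C (∑ b, p b j * q b k) * u j := by
      rw [map_sum, Finset.sum_mul]
      exact Finset.sum_congr rfl fun b _ => by rw [C_mul]; ring
    rw [h1, h.expand]
    split_ifs <;> simp
  simp [this]

/-! ### Staircase matrices -/

section Staircase

variable {ι : Type*} {d : ι → ℕ} {m : ℕ}

/-- The polynomial matrix with rows `∑ l ≤ d i, D ^ l v_(i, l)`. -/
noncomputable def stairGen (v : (i : ι) × Fin (d i + 1) → Fin n → F) : Matrix ι (Fin n) F[X] :=
  fun i => ∑ l : Fin (d i + 1), (X : F[X]) ^ (l : ℕ) • constWord (v ⟨i, l⟩)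

/-- The polynomial matrix with rows `D q_(i, l + 1) - q_(i, l)` for `l < d i` and `q_k`. -/
noncomputable def stairDual (q : ((i : ι) × Fin (d i + 1)) ⊕ Fin m → Fin n → F) :
    Matrix (((i : ι) × Fin (d i)) ⊕ Fin m) (Fin n) F[X] :=
  Sum.elim (fun x => (X : F[X]) • constWord (q (Sum.inl ⟨x.1, x.2.succ⟩)) -
      constWord (q (Sum.inl ⟨x.1, x.2.castSucc⟩)))
    (fun k => constWord (q (Sum.inr k)))

theorem stairGen_apply (v : (i : ι) × Fin (d i + 1) → Fin n → F) (i : ι) (j : Fin n) :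
    stairGen v i j = ∑ l : Fin (d i + 1), X ^ (l : ℕ) * C (v ⟨i, l⟩ j) := by
  simp [stairGen, constWord]

theorem coeff_stairGen (v : (i : ι) × Fin (d i + 1) → Fin n → F) (i : ι) (j : Fin n)
    (l : Fin (d i + 1)) : (stairGen v i j).coeff l = v ⟨i, l⟩ j := by
  simp only [stairGen_apply, finsetSum_coeff, coeff_mul_C, coeff_X_pow, Fin.val_inj]
  simp

theorem natDegree_stairGen_le (v : (i : ι) × Fin (d i + 1) → Fin n → F) (i : ι) (j : Fin n) :
    (stairGen v i j).natDegree ≤ d i := by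
  rw [stairGen_apply]
  refine natDegree_sum_le_of_forall_le _ _ fun l _ => ?_
  rw [mul_comm]
  exact (natDegree_C_mul_X_pow_le _ _).trans (Nat.lt_succ_iff.1 l.2)

variable {p q : ((i : ι) × Fin (d i + 1)) ⊕ Fin m → Fin n → F}
  {v : (i : ι) × Fin (d i + 1) → Fin n → F}

theorem coeff_stairDual_inl (x : (i : ι) × Fin (d i)) (j : Fin n) :
    (stairDual q (Sum.inl x) j).coeff 1 = q (Sum.inl ⟨x.1, x.2.succ⟩) j := by
  simp [stairDual, constWord, coeff_C]

theorem lprod_stairGen (u : Fin n → F[X]) (i : ι) :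
    lprod u (stairGen v i) = ∑ l : Fin (d i + 1),
      LaurentPolynomial.T (-(l : ℤ)) * atD (coordinate (v ⟨i, l⟩) u) := by
  rw [stairGen, lprod_sum_right]
  refine Finset.sum_congr rfl fun l _ => ?_
  rw [lprod_smul_right, lprod_constWord_right, atInvD, toLaurent_X_pow, LaurentPolynomial.invert_T]

theorem lprod_stairDual_inl (u : Fin n → F[X]) (x : (i : ι) × Fin (d i)) :
    lprod u (stairDual q (Sum.inl x)) =
      LaurentPolynomial.T (-1) * atD (coordinate (q (Sum.inl ⟨x.1, x.2.succ⟩)) u) -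
        atD (coordinate (q (Sum.inl ⟨x.1, x.2.castSucc⟩)) u) := by
  rw [stairDual, Sum.elim_inl, lprod_comm, lprod_sub_left, map_sub, ← lprod_comm, ← lprod_comm,
    lprod_smul_right, lprod_constWord_right, lprod_constWord_right, atInvD, toLaurent_X,
    LaurentPolynomial.invert_T]

variable [Fintype ι] [DecidableEq ι]

theorem isRowReduced_stairGen (h : IsDualPair p q) (hv : ∀ a, p (Sum.inl a) = v a) :
    IsRowReduced (stairGen v) d := by
  refine ⟨natDegree_stairGen_le v,
    Matrix.of fun j i => q (Sum.inl ⟨i, Fin.last _⟩) j, ?_⟩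
  ext i i'
  have h1 : ∀ j, (stairGen v i j).coeff (d i) = v ⟨i, Fin.last _⟩ j := fun j =>
    coeff_stairGen v i j (Fin.last _)
  have h2 := h.dot (Sum.inl ⟨i, Fin.last _⟩) (Sum.inl ⟨i', Fin.last _⟩)
  rw [hv] at h2
  simp only [Matrix.mul_apply, Matrix.of_apply, h1, Matrix.one_apply]
  refine h2.trans ?_
  by_cases hi : i = i'
  · subst hi; simp
  · simp [hi]

theorem coordinate_stairGen (h : IsDualPair p q) (hv : ∀ a, p (Sum.inl a) = v a) (i : ι)
    (b : ((i : ι) × Fin (d i + 1)) ⊕ Fin m) :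
    coordinate (q b) (stairGen v i) =
      ∑ l : Fin (d i + 1), if Sum.inl ⟨i, l⟩ = b then X ^ (l : ℕ) else 0 := by
  rw [stairGen, coordinate_sum]
  refine Finset.sum_congr rfl fun l _ => ?_
  rw [coordinate_smul, coordinate_constWord, ← hv, dotProduct_comm, h.dot]
  split_ifs <;> simp

/-- The constant column `q_(i, 0)` meets only the constant term of row `i` and no other row. -/
theorem isBasic_stairGen (h : IsDualPair p q) (hv : ∀ a, p (Sum.inl a) = v a) :
    IsBasic (stairGen v) := by
  refine ⟨Matrix.of fun j i => C (q (Sum.inl ⟨i, 0⟩) j), ?_⟩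
  ext1 i i'
  have h1 := coordinate_stairGen h hv i (Sum.inl ⟨i', 0⟩)
  rw [coordinate] at h1
  simp only [Matrix.mul_apply, Matrix.of_apply, mul_comm (stairGen v i _), h1, Matrix.one_apply]
  by_cases hi : i = i'
  · subst hi
    simp only [Sum.inl.injEq, Sigma.mk.injEq, heq_eq_eq, true_and, if_true]
    simp
  · simp [hi]

/-- The leading vectors `q_(i, l + 1)` and `q_k` are distinct members of a basis, hence inverted by
the matching vectors of `p`. -/
theorem isRowReduced_stairDual (h : IsDualPair p q) :
    IsRowReduced (stairDual q) (Sum.elim (fun _ => 1) (fun _ => 0)) := by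
  refine ⟨?_, Matrix.of fun j => Sum.elim (fun x => p (Sum.inl ⟨x.1, x.2.succ⟩) j)
    (fun k => p (Sum.inr k) j), ?_⟩
  · rintro (x | k) j
    · simp only [stairDual, constWord, Sum.elim_inl, Pi.sub_apply, Pi.smul_apply, smul_eq_mul]
      refine (natDegree_sub_le _ _).trans (max_le ?_ ?_)
      · rw [mul_comm]
        exact (natDegree_C_mul_le _ _).trans natDegree_X_le
      · simp
    · simp [stairDual, constWord]
  · have hd := h.symm.dot
    simp only [dotProduct] at hd
    ext (⟨i, l⟩ | k) (⟨i', l'⟩ | k')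
    · simp only [Matrix.mul_apply, Matrix.of_apply, Sum.elim_inl, coeff_stairDual_inl, hd,
        Matrix.one_apply]
      by_cases hi : i = i'
      · subst hi; simp
      · simp [hi]
    · simp [Matrix.mul_apply, coeff_stairDual_inl, hd]
    · simp [Matrix.mul_apply, stairDual, constWord, hd]
    · simp [Matrix.mul_apply, stairDual, constWord, hd, Matrix.one_apply]

theorem overallConstraintLength_stairDual (h : IsDualPair p q) :
    overallConstraintLength (stairDual q) = ∑ i, d i := by
  rw [(isRowReduced_stairDual h).overallConstraintLength_eq]
  simp [Fintype.sum_sum_type]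

theorem isBasic_stairDual (h : IsDualPair p q) : IsBasic (stairDual q) := by
  -- `R' b c` is the coordinate along `p b` of column `c` of the right inverse. Along a staircase
  -- the recursion `X * R' (l + 1) - R' l = δ` has to hold; starting from zero at the top index and
  -- descending gives `-X ^ (l' - l)` for `l ≤ l'`.
  let R' : ((i : ι) × Fin (d i + 1)) ⊕ Fin m → ((i : ι) × Fin (d i)) ⊕ Fin m → F[X] :=
    Sum.elim (fun x => Sum.elim
      (fun y => if x.1 = y.1 ∧ (x.2 : ℕ) ≤ y.2 then -X ^ ((y.2 : ℕ) - x.2) else 0) (fun _ => 0))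
      (fun k => Sum.elim (fun _ => 0) (fun k' => if k = k' then 1 else 0))
  let w : ((i : ι) × Fin (d i)) ⊕ Fin m → Fin n → F[X] := fun c => ∑ b, R' b c • constWord (p b)
  have hw : ∀ b c, coordinate (q b) (w c) = R' b c := by
    intro b c
    simp only [w, coordinate_sum, coordinate_smul, coordinate_constWord, h.symm.dot, apply_ite C]
    simp
  have hw' : ∀ b c, ∑ j, constWord (q b) j * w c j = R' b c := hw
  refine ⟨Matrix.of fun j c => w c j, ?_⟩
  refine Matrix.ext ?_
  rintro (⟨i, l⟩ | k) c
  · have h1 : (stairDual q * Matrix.of fun j c => w c j) (Sum.inl ⟨i, l⟩) c =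
        X * R' (Sum.inl ⟨i, l.succ⟩) c - R' (Sum.inl ⟨i, l.castSucc⟩) c := by
      rw [← hw', ← hw', Finset.mul_sum, ← Finset.sum_sub_distrib]
      rw [Matrix.mul_apply]
      simp [stairDual, sub_mul, mul_assoc]
    rw [h1]
    rcases c with ⟨i', l'⟩ | k'
    · simp only [R', Sum.elim_inl, Fin.val_succ, Fin.val_castSucc]
      by_cases hi : i = i'
      · subst hi
        rcases lt_trichotomy (l : ℕ) l' with hl | hl | hl
        · have h2 : (l' : ℕ) - l = (l' - (l + 1)) + 1 := by omega
          have h3 : l ≠ l' := fun h => hl.ne (congrArg _ h)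
          rw [if_pos ⟨rfl, hl⟩, if_pos ⟨rfl, hl.le⟩, h2, pow_succ, Matrix.one_apply_ne (by simpa)]
          ring
        · obtain rfl := Fin.ext hl
          simp
        · have h3 : l ≠ l' := fun h => hl.ne (congrArg _ h.symm)
          rw [if_neg (by simp; omega), if_neg (by simp; omega), Matrix.one_apply_ne (by simpa)]
          simp
      · simp [hi]
    · simp [R']
  · have h1 : (stairDual q * Matrix.of fun j c => w c j) (Sum.inr k) c = R' (Sum.inr k) c := by
      rw [← hw']; rfl
    rw [h1]
    rcases c with ⟨i', l'⟩ | k' <;> simp [R', Matrix.one_apply]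

/-! The dual code of the code generated by a staircase matrix. -/

theorem T_neg_mul_eq_zero_iff (k : ℕ) (f g : F[X]) :
    LaurentPolynomial.T (-(k : ℤ)) * atD f - atD g = 0 ↔ f = X ^ k * g := by
  rw [sub_eq_zero, ← toLaurent_inj, map_mul, toLaurent_X_pow]
  constructor
  · intro h
    rw [← atD, ← atD, ← h, ← mul_assoc, ← LaurentPolynomial.T_add, add_neg_cancel,
      LaurentPolynomial.T_zero, one_mul]
  · intro h
    rw [atD, h, ← mul_assoc, ← LaurentPolynomial.T_add, neg_add_cancel,
      LaurentPolynomial.T_zero, one_mul]; rfl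

/-- Orthogonality to `D q_(i, l + 1) - q_(i, l)` says that the coordinate of `x` along `p_(i, l +
1)` is `D` times that along `p_(i, l)`. The coordinates on a staircase are thus `D ^ l` times the
first one, so they assemble to a multiple of row `i`. -/
theorem dual_stairDual (h : IsDualPair p q) (hv : ∀ a, p (Sum.inl a) = v a) :
    dual (rowModule (stairDual q)) = rowModule (stairGen v) := by
  apply le_antisymm
  · intro x hx
    rw [mem_dual_rowModule] at hx
    have h1 : ∀ i, ∀ l : Fin (d i + 1), coordinate (q (Sum.inl ⟨i, l⟩)) x =
        X ^ (l : ℕ) * coordinate (q (Sum.inl ⟨i, 0⟩)) x := by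
      intro i l
      induction l using Fin.induction with
      | zero => simp
      | succ l ih =>
        have h2 := hx (Sum.inl ⟨i, l⟩)
        rw [lprod_stairDual_inl] at h2
        have h3 := (T_neg_mul_eq_zero_iff 1 _ _).1 h2
        rw [h3, ih, Fin.val_succ, Fin.val_castSucc, pow_succ]
        ring
    have h2 : ∀ k, coordinate (q (Sum.inr k)) x = 0 := by
      intro k
      have := hx (Sum.inr k)
      rw [stairDual, Sum.elim_inr, lprod_constWord_right] at this
      exact toLaurent_eq_zero.1 this
    rw [← h.symm.sum_coordinate x, Fintype.sum_sum_type, Fintype.sum_sigma]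
    refine Submodule.add_mem _ (Submodule.sum_mem _ fun i _ => ?_)
      (Submodule.sum_mem _ fun k _ => ?_)
    · have : ∑ l : Fin (d i + 1), coordinate (q (Sum.inl ⟨i, l⟩)) x • constWord (p (Sum.inl ⟨i, l⟩))
          = coordinate (q (Sum.inl ⟨i, 0⟩)) x • stairGen v i := by
        rw [stairGen, Finset.smul_sum]
        refine Finset.sum_congr rfl fun l _ => ?_
        rw [h1, hv, smul_smul, mul_comm]
      rw [this]
      exact Submodule.smul_mem _ _ (row_mem_rowModule _ i)
    · rw [h2, zero_smul]
      exact zero_mem _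
  · refine rowModule_le_iff.2 fun i => mem_dual_rowModule.2 ?_
    rintro (⟨i', l⟩ | k)
    · rw [lprod_stairDual_inl]
      refine (T_neg_mul_eq_zero_iff 1 _ _).2 ?_
      rw [coordinate_stairGen h hv, coordinate_stairGen h hv]
      by_cases hi : i = i'
      · subst hi
        simp only [Sum.inl.injEq, Sigma.mk.injEq, heq_eq_eq, true_and]
        simp [pow_succ, mul_comm]
      · simp [hi]
    · rw [stairDual, Sum.elim_inr, lprod_constWord_right, coordinate_stairGen h hv]
      simp [atD]

/-- Modulo the rows of `stairDual`, all of staircase `i` reduces to multiples of its last vector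
`q_(i, d i)`; orthogonality to row `i` says that the total multiple vanishes. -/
theorem dual_stairGen (h : IsDualPair p q) (hv : ∀ a, p (Sum.inl a) = v a) :
    dual (rowModule (stairGen v)) = rowModule (stairDual q) := by
  apply le_antisymm
  · intro u hu
    rw [mem_dual_rowModule] at hu
    set W := rowModule (stairDual q)
    -- Modulo `W`, `q_(i, l)` equals `D q_(i, l + 1)`; descending induction from `l = d i` iterates
    -- this.
    have hstep : ∀ i, ∀ l : Fin (d i + 1), constWord (q (Sum.inl ⟨i, l⟩)) -
        (X : F[X]) ^ (d i - l) • constWord (q (Sum.inl ⟨i, Fin.last _⟩)) ∈ W := by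
      intro i l
      induction l using Fin.reverseInduction with
      | last => simp
      | cast l ih =>
        have h1 : (d i - (l.castSucc : ℕ)) = (d i - (l.succ : ℕ)) + 1 := by
          simp only [Fin.val_castSucc, Fin.val_succ]; omega
        have h2 := W.sub_mem (W.smul_mem (X : F[X]) ih) (row_mem_rowModule _ (Sum.inl ⟨i, l⟩))
        convert h2 using 1
        rw [h1, stairDual, Sum.elim_inl, pow_succ, mul_comm, smul_sub, mul_smul]
        abel
    -- Multiplication by `D ^ d i` clears the negative powers in the orthogonality relation.
    have hsum : ∀ i, ∑ l : Fin (d i + 1),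
        coordinate (v ⟨i, l⟩) u * (X : F[X]) ^ (d i - (l : ℕ)) = 0 := by
      intro i
      have h1 := hu i
      rw [lprod_stairGen] at h1
      rw [← toLaurent_eq_zero, map_sum]
      rw [← mul_zero (LaurentPolynomial.T (d i : ℤ)), ← h1, Finset.mul_sum]
      refine Finset.sum_congr rfl fun l _ => ?_
      rw [map_mul, toLaurent_X_pow, ← mul_assoc, ← LaurentPolynomial.T_add, mul_comm, atD,
        Nat.cast_sub (Nat.lt_succ_iff.1 l.2), sub_eq_add_neg]
    rw [← h.sum_coordinate u, Fintype.sum_sum_type, Fintype.sum_sigma]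
    refine Submodule.add_mem _ (Submodule.sum_mem _ fun i _ => ?_)
      (Submodule.sum_mem _ fun k _ => Submodule.smul_mem _ _ (row_mem_rowModule _ (Sum.inr k)))
    have h2 : ∑ l : Fin (d i + 1), coordinate (p (Sum.inl ⟨i, l⟩)) u •
          constWord (q (Sum.inl ⟨i, l⟩)) =
        ∑ l : Fin (d i + 1), coordinate (v ⟨i, l⟩) u • (constWord (q (Sum.inl ⟨i, l⟩)) -
          (X : F[X]) ^ (d i - (l : ℕ)) • constWord (q (Sum.inl ⟨i, Fin.last _⟩))) := by
      simp only [smul_sub, Finset.sum_sub_distrib, smul_smul, ← Finset.sum_smul, hsum, zero_smul,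
        sub_zero, hv]
    rw [h2]
    exact Submodule.sum_mem _ fun l _ => W.smul_mem _ (hstep i l)
  · rw [← dual_stairDual h hv]
    exact le_dual_dual _

end Staircase

/-! ### Reduced basic CSS matrices -/

theorem IsReducedBasic.congr {ι κ : Type*} [Fintype ι] [DecidableEq ι] [Fintype κ]
    {G G' : Matrix ι κ F[X]} (h : IsReducedBasic G) (hb : IsBasic G')
    (hr : rowModule G' = rowModule G)
    (ho : overallConstraintLength G' = overallConstraintLength G) : IsReducedBasic G' :=
  ⟨hb, fun G'' hb' hr' => ho.trans_le (h.2 G'' hb' (hr'.trans hr))⟩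

/-- `A` and `B` need not be row reduced themselves. Row reduced generators `A'`, `B'` of the same
codes show what the least overall constraint length of the block matrix is, and `A`, `B` attain it
by their own minimality. -/
theorem IsReducedBasic.cssMatrix {ι κ : Type*} [Fintype ι] [DecidableEq ι] [Fintype κ]
    [DecidableEq κ] {A A' : Matrix ι (Fin n) F[X]} {B B' : Matrix κ (Fin n) F[X]}
    {d : ι → ℕ} {d' : κ → ℕ} (hA : IsReducedBasic A) (hB : IsReducedBasic B)
    (hA' : IsRowReduced A' d) (hbA' : IsBasic A') (hrA : rowModule A = rowModule A')
    (hB' : IsRowReduced B' d') (hbB' : IsBasic B') (hrB : rowModule B = rowModule B') :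
    IsReducedBasic (cssMatrix A B) := by
  refine ((hA'.cssMatrix hB').isReducedBasic (hbA'.cssMatrix hbB')).congr
    (hA.1.cssMatrix hB.1) (rowModule_cssMatrix_congr hrA hrB) ?_
  rw [overallConstraintLength_cssMatrix, overallConstraintLength_cssMatrix,
    hA.overallConstraintLength_eq (hA'.isReducedBasic hbA') hrA,
    hB.overallConstraintLength_eq (hB'.isReducedBasic hbB') hrB]

theorem IsRowReduced.memory_eq {ι κ : Type*} [Fintype ι] [DecidableEq ι] [Fintype κ]
    {G : Matrix ι κ F[X]} {d : ι → ℕ} (h : IsRowReduced G d) {μ : ℕ} (hd : ∀ i, d i ≤ μ)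
    (i : ι) (hi : d i = μ) : memory G = μ := by
  refine le_antisymm (Finset.sup_le fun i _ => (h.constraintLength_eq i).trans_le (hd i)) ?_
  rw [← hi, ← h.constraintLength_eq i]
  exact Finset.le_sup (f := constraintLength G) (Finset.mem_univ i)

theorem overallConstraintLength_submatrix {ι ι' κ : Type*} [Fintype ι] [Fintype ι'] [Fintype κ]
    (G : Matrix ι κ F[X]) (e : ι' ≃ ι) :
    overallConstraintLength (G.submatrix e id) = overallConstraintLength G :=
  Equiv.sum_comp e (constraintLength G)

/-! ### Weights -/

theorem exists_isLeast_of_nonempty {S : Set ℕ} (h : S.Nonempty) : ∃ k, IsLeast S k :=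
  ⟨sInf S, Nat.sInf_mem h, fun _ hk => Nat.sInf_le hk⟩

theorem freeDist_le {V : Submodule F[X] (Fin n → F[X])} {v : Fin n → F[X]} (hv : v ∈ V)
    (h0 : v ≠ 0) : freeDist V ≤ weight v :=
  iInf_le (fun v : {v : Fin n → F[X] // v ∈ V ∧ v ≠ 0} => (weight v.1 : ℕ∞)) ⟨v, hv, h0⟩

theorem freeDist_le_of_isLeast {V W : Submodule F[X] (Fin n → F[X])} {k : ℕ}
    (h : IsLeast (weight '' ((V : Set (Fin n → F[X])) \ W)) k) : freeDist V ≤ k := by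
  obtain ⟨v, ⟨hv, hv'⟩, rfl⟩ := h.1
  exact freeDist_le hv fun h0 => hv' (h0 ▸ W.zero_mem)

/-- The coefficient vector of `D ^ t`. -/
def coeffVec (u : Fin n → F[X]) (t : ℕ) : Fin n → F := fun j => (u j).coeff t

theorem coeff_coordinate (c : Fin n → F) (u : Fin n → F[X]) (t : ℕ) :
    (coordinate c u).coeff t = c ⬝ᵥ coeffVec u t := by
  simp [coordinate, coeffVec, dotProduct, finsetSum_coeff]

open Classical in
theorem minDist_le {C : Submodule F (Fin n → F)} {v : Fin n → F} (hv : v ∈ C)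
    (h0 : v ≠ 0) : minDist C ≤ hammingNorm v :=
  iInf_le (fun v : {v : Fin n → F // v ∈ C ∧ v ≠ 0} => (hammingNorm v.1 : ℕ∞)) ⟨v, hv, h0⟩

open Classical in
theorem sum_hammingNorm_coeffVec_le (u : Fin n → F[X]) (T : Finset ℕ) :
    ∑ t ∈ T, hammingNorm (coeffVec u t) ≤ weight u := by
  simp only [hammingNorm, Finset.card_filter, weight]
  rw [Finset.sum_comm]
  refine Finset.sum_le_sum fun j _ => ?_
  rw [← Finset.card_filter]
  refine Finset.card_le_card fun t ht => ?_
  exact mem_support_iff.2 (Finset.mem_filter.1 ht).2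

open Classical in
theorem weight_constWord (c : Fin n → F) : weight (constWord c) = hammingNorm c := by
  simp only [hammingNorm, Finset.card_filter, weight, constWord]
  refine Finset.sum_congr rfl fun j _ => ?_
  split_ifs with h
  · rw [support_C h, Finset.card_singleton]
  · simp [not_not.1 h]

theorem exists_coeffVec_ne_zero {u : Fin n → F[X]} (h : u ≠ 0) : ∃ t, coeffVec u t ≠ 0 := by
  by_contra! h0
  exact h (funext fun j => Polynomial.ext fun t => congrFun (h0 t) j)

/-! ### Polynomial matrices -/

section PolyMatrix

variable {ι : Type*} {μ : ℕ} {A : ℕ → Matrix ι (Fin n) F}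

theorem polyMatrix_row (i : ι) :
    polyMatrix μ A i = ∑ l ∈ Finset.range (μ + 1), (X : F[X]) ^ l • constWord (A l i) := by
  ext1 j
  simp [polyMatrix, Matrix.sum_apply, constWord]

theorem polyMatrix_eq_stairGen {d : ι → ℕ} (hd : ∀ i, d i ≤ μ)
    (hA : ∀ i, ∀ l, d i < l → l ≤ μ → A l i = 0) :
    polyMatrix μ A = stairGen (fun x : (i : ι) × Fin (d i + 1) => A x.2 x.1) := by
  funext i
  rw [polyMatrix_row, stairGen, Fin.sum_univ_eq_sum_range
    (fun l => (X : F[X]) ^ l • constWord (A l i)) (d i + 1)]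
  refine (Finset.sum_subset (Finset.range_mono (Nat.succ_le_succ (hd i))) fun l hl hl' => ?_).symm
  rw [Finset.mem_range] at hl hl'
  rw [hA i l (by omega) (by omega)]
  ext1 j
  simp [constWord]

/-- Every coefficient vector of a codeword is orthogonal to the code with parity check matrix `B`,
and a nonzero one already has enough weight. -/
theorem minDist_blockDual_le_freeDist [Fintype ι] {κ : Type*} (B : Matrix κ (Fin n) F)
    (hA : ∀ l ≤ μ, ∀ i, A l i = 0 ∨ ∃ k, A l i = B k) :
    minDist (blockDual (codeOfParityCheck B)) ≤ freeDist (rowModule (polyMatrix μ A)) := by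
  classical
  refine le_iInf ?_
  rintro ⟨_, ⟨c, rfl⟩, h0⟩
  obtain ⟨t, ht⟩ := exists_coeffVec_ne_zero h0
  set v := (polyMatrix μ A).vecMulLinear c with hv
  have hmem : coeffVec v t ∈ blockDual (codeOfParityCheck B) := by
    intro w hw
    have hB : ∀ k, B k ⬝ᵥ w = 0 := fun k => congrFun (LinearMap.mem_ker.1 hw) k
    have hv' : v = ∑ i, c i • polyMatrix μ A i := by
      ext1 j
      simp [hv, Matrix.vecMul, dotProduct]
    rw [dotProduct_comm, ← coeff_coordinate, hv', coordinate_sum, Finset.sum_eq_zero, coeff_zero]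
    intro i _
    rw [coordinate_smul, polyMatrix_row, coordinate_sum, Finset.sum_eq_zero, mul_zero]
    intro l hl
    rw [coordinate_smul, coordinate_constWord, dotProduct_comm]
    rcases hA l (Nat.lt_succ_iff.1 (Finset.mem_range.1 hl)) i with h | ⟨k, h⟩
    · rw [h, zero_dotProduct, C_0, mul_zero]
    · rw [h, hB, C_0, mul_zero]
  refine (minDist_le hmem ht).trans ?_
  have := sum_hammingNorm_coeffVec_le v {t}
  rw [Finset.sum_singleton] at this
  exact_mod_cast this

variable [Fintype ι] [DecidableEq ι]

/-- The Laurent condition is multiplied by `D ^ μ`, which makes it polynomial. -/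
theorem mem_dual_polyMatrix {u : Fin n → F[X]} :
    u ∈ dual (rowModule (polyMatrix μ A)) ↔
      ∀ i, ∑ l ∈ Finset.range (μ + 1), X ^ (μ - l) * coordinate (A l i) u = 0 := by
  rw [mem_dual_rowModule]
  refine forall_congr' fun i => ?_
  rw [← toLaurent_eq_zero, ← (LaurentPolynomial.isUnit_T (R := F) (μ : ℤ)).mul_right_eq_zero,
    polyMatrix_row, lprod_sum_right, Finset.mul_sum, map_sum]
  refine Eq.congr_left (Finset.sum_congr rfl fun l hl => ?_)
  rw [lprod_smul_right, lprod_constWord_right, atInvD, toLaurent_X_pow, LaurentPolynomial.invert_T,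
    map_mul, toLaurent_X_pow, ← mul_assoc, ← LaurentPolynomial.T_add,
    Nat.cast_sub (Nat.lt_succ_iff.1 (Finset.mem_range.1 hl)), sub_eq_add_neg, atD]

/-- If the coefficient vector of `D ^ t` of a word of the dual code is the only one that meets
`A l` in some shift, then it is orthogonal to the rows of `A l`. -/
theorem dotProduct_coeffVec_eq_zero {u : Fin n → F[X]}
    (hu : u ∈ dual (rowModule (polyMatrix μ A))) {l t : ℕ} (hl : l ≤ μ)
    (h : ∀ l' ≤ μ, l' ≠ l → ∀ t', t' + l = t + l' → coeffVec u t' = 0) (i : ι) :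
    A l i ⬝ᵥ coeffVec u t = 0 := by
  -- At `D ^ (t + μ - l)` the block `A l'` meets the coefficient vector at time `t' = t + l' - l`,
  -- which is zero by `h` unless `l' = l`.
  have h1 := congrArg (fun f => f.coeff (t + μ - l)) (mem_dual_polyMatrix.1 hu i)
  simp only [finsetSum_coeff, coeff_zero, coeff_X_pow_mul'] at h1
  rw [Finset.sum_eq_single_of_mem l (Finset.mem_range.2 (by omega)), if_pos (by omega),
    coeff_coordinate] at h1
  · rwa [show t + μ - l - (μ - l) = t by omega] at h1
  · intro l' hl' hne
    rw [Finset.mem_range] at hl'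
    split_ifs with hc
    · rw [coeff_coordinate, h l' (by omega) hne _ (by omega), dotProduct_zero]
    · rfl

/-- In the extreme shifts of the orthogonality relation the last nonzero coefficient vector of `u`
meets only `A 0`, and the first only `A μ`. If these times differ, their weights add; if they agree,
`u` is a monomial times a constant word orthogonal to every block. -/
theorem min_minDist_le_freeDist_dual {κ : Type*} (B : Matrix κ (Fin n) F)
    (hB : ∀ k, ∃ l ≤ μ, ∃ i, B k = A l i) :
    min (minDist (codeOfParityCheck (A 0)) + minDist (codeOfParityCheck (A μ)))
      (minDist (codeOfParityCheck B)) ≤ freeDist (dual (rowModule (polyMatrix μ A))) := by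
  classical
  refine le_iInf ?_
  rintro ⟨u, hu, h0⟩
  have hex := exists_coeffVec_ne_zero h0
  let a := Nat.find hex
  have ha : coeffVec u a ≠ 0 := Nat.find_spec hex
  have ha' : ∀ t < a, coeffVec u t = 0 := fun t ht => not_not.1 (Nat.find_min hex ht)
  obtain ⟨N, hN⟩ : ∃ N, ∀ t, N < t → coeffVec u t = 0 :=
    ⟨Finset.univ.sup fun j => (u j).natDegree, fun t ht => funext fun j =>
      coeff_eq_zero_of_natDegree_lt ((Finset.le_sup (f := fun j => (u j).natDegree)
        (Finset.mem_univ j)).trans_lt ht)⟩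
  let b := Nat.findGreatest (fun t => coeffVec u t ≠ 0) N
  have haN : a ≤ N := by
    by_contra! h
    exact ha (hN a h)
  have hb : coeffVec u b ≠ 0 :=
    Nat.findGreatest_spec (P := fun t => coeffVec u t ≠ 0) haN ha
  have hab : a ≤ b := Nat.le_findGreatest haN ha
  have hb' : ∀ t, b < t → coeffVec u t = 0 := by
    intro t ht
    rcases le_or_gt t N with h | h
    · exact not_not.1 (Nat.findGreatest_is_greatest ht h)
    · exact hN t h
  rcases hab.eq_or_lt with hab | hab
  · refine (min_le_right _ _).trans ((minDist_le (v := coeffVec u a) ?_ ha).trans ?_)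
    · refine LinearMap.mem_ker.2 (funext fun k => ?_)
      obtain ⟨l, hl, i, hk⟩ := hB k
      change B k ⬝ᵥ coeffVec u a = 0
      rw [hk]
      refine dotProduct_coeffVec_eq_zero hu hl (fun l' _ hne t' ht' => ?_) i
      rcases lt_or_gt_of_ne (show t' ≠ a by omega) with h | h
      · exact ha' _ h
      · exact hb' _ (hab ▸ h)
    · have := sum_hammingNorm_coeffVec_le u {a}
      rw [Finset.sum_singleton] at this
      exact_mod_cast this
  · refine (min_le_left _ _).trans ?_
    have h1 : coeffVec u b ∈ codeOfParityCheck (A 0) :=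
      LinearMap.mem_ker.2 (funext fun i => dotProduct_coeffVec_eq_zero hu (Nat.zero_le _)
        (fun l' _ hne t' ht' => hb' _ (by omega)) i)
    have h2 : coeffVec u a ∈ codeOfParityCheck (A μ) :=
      LinearMap.mem_ker.2 (funext fun i => dotProduct_coeffVec_eq_zero hu le_rfl
        (fun l' _ hne t' ht' => ha' _ (by omega)) i)
    refine (add_le_add (minDist_le h1 hb) (minDist_le h2 ha)).trans ?_
    have := sum_hammingNorm_coeffVec_le u {b, a}
    rw [Finset.sum_pair hab.ne'] at this
    exact_mod_cast this

/-- A word orthogonal to all blocks is, as a constant word, in the dual code with the same weight.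
-/
theorem freeDist_dual_le_minDist {κ : Type*} (B : Matrix κ (Fin n) F)
    (hA : ∀ l ≤ μ, ∀ i, A l i = 0 ∨ ∃ k, A l i = B k) :
    freeDist (dual (rowModule (polyMatrix μ A))) ≤ minDist (codeOfParityCheck B) := by
  classical
  refine le_iInf ?_
  rintro ⟨w, hw, h0⟩
  have hB : ∀ k, B k ⬝ᵥ w = 0 := fun k => congrFun (LinearMap.mem_ker.1 hw) k
  have h1 : constWord w ∈ dual (rowModule (polyMatrix μ A)) := by
    refine mem_dual_polyMatrix.2 fun i => Finset.sum_eq_zero fun l hl => ?_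
    rw [coordinate_constWord]
    rcases hA l (Nat.lt_succ_iff.1 (Finset.mem_range.1 hl)) i with h | ⟨k, h⟩
    · rw [h, zero_dotProduct, C_0, mul_zero]
    · rw [h, hB, C_0, mul_zero]
  have h2 : constWord w ≠ 0 := fun h => h0 (funext fun j => C_eq_zero.1 (congrFun h j))
  refine (freeDist_le h1 h2).trans ?_
  rw [weight_constWord]

end PolyMatrix

/-! ### The blocks of the construction -/

section Construction

variable {r μ : ℕ} {s : ℕ → ℕ}

/-- The degree of the `i`-th row of `G₂`: the last index `j ≤ μ` with `i < s j`. -/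
def rowDegree (s : ℕ → ℕ) (μ i : ℕ) : ℕ := Nat.findGreatest (fun j => i < s j) μ

theorem rowDegree_le (s : ℕ → ℕ) (μ i : ℕ) : rowDegree s μ i ≤ μ := Nat.findGreatest_le μ

theorem antitone_of_step (hs : ∀ i < μ, s (i + 1) ≤ s i) {j k : ℕ} (hjk : j ≤ k) (hk : k ≤ μ) :
    s k ≤ s j := by
  induction k, hjk using Nat.le_induction with
  | base => exact le_rfl
  | succ k hjk ih => exact (hs k (by omega)).trans (ih (by omega))

theorem lt_iff_le_rowDegree (hs : ∀ i < μ, s (i + 1) ≤ s i) {i j : ℕ} (hi : i < s 0)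
    (hj : j ≤ μ) : i < s j ↔ j ≤ rowDegree s μ i := by
  constructor
  · exact fun h => Nat.le_findGreatest hj h
  · intro h
    -- `Nat.findGreatest` would return `0` by default as well; `hi` makes the defining property true
    -- at that index too.
    have h1 : i < s (rowDegree s μ i) :=
      Nat.findGreatest_spec (P := fun j => i < s j) (Nat.zero_le μ) hi
    exact h1.trans_le (antitone_of_step hs h (rowDegree_le _ _ _))

/-- Double counting of the pairs `(i, j)` with `i < s (j + 1)`, as for a partition and its
conjugate. -/
theorem sum_rowDegree (hs : ∀ i < μ, s (i + 1) ≤ s i) :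
    ∑ i : Fin (s 0), rowDegree s μ i = ∑ j ∈ Finset.range μ, s (j + 1) := by
  have h1 : ∀ i : Fin (s 0), rowDegree s μ i =
      ∑ j ∈ Finset.range μ, if (i : ℕ) < s (j + 1) then 1 else 0 := by
    intro i
    rw [← Finset.card_filter, ← Finset.card_range (rowDegree s μ i)]
    congr 1
    ext j
    have := rowDegree_le s μ i
    simp only [Finset.mem_range, Finset.mem_filter]
    constructor
    · intro h
      exact ⟨by omega, (lt_iff_le_rowDegree hs i.2 (by omega)).2 h⟩
    · rintro ⟨h, h'⟩
      exact (lt_iff_le_rowDegree hs i.2 h).1 h'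
  rw [Finset.sum_congr rfl fun i _ => h1 i, Finset.sum_comm]
  refine Finset.sum_congr rfl fun j hj => ?_
  have h2 : s (j + 1) ≤ s 0 :=
    antitone_of_step hs (Nat.zero_le _) (Finset.mem_range.1 hj)
  rw [Fin.sum_univ_eq_sum_range (fun i => if i < s (j + 1) then 1 else 0), ← Finset.card_filter]
  conv_rhs => rw [← Finset.card_range (s (j + 1))]
  congr 1
  ext i
  simp only [Finset.mem_range, Finset.mem_filter]
  omega

/-- Summation by parts, after the reflection `k = μ - i`; the added term `k = 0` vanishes. -/
theorem sum_mul_sub_eq (s : ℕ → ℕ) (μ : ℕ) (hs : ∀ i < μ, s (i + 1) ≤ s i) :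
    μ * s μ + ∑ i ∈ Finset.Icc 1 (μ - 1), (μ - i) * (s (μ - i) - s (μ - i + 1)) =
      ∑ j ∈ Finset.range μ, s (j + 1) := by
  have h1 : ∑ i ∈ Finset.Icc 1 (μ - 1), (μ - i) * (s (μ - i) - s (μ - i + 1)) =
      ∑ k ∈ Finset.range μ, k * (s k - s (k + 1)) := by
    rw [Finset.sum_nbij' (t := Finset.Icc 1 (μ - 1)) (g := fun k => k * (s k - s (k + 1)))
      (fun i => μ - i) (fun i => μ - i)]
    · refine Finset.sum_subset (fun k hk => ?_) fun k hk hk' => ?_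
      · simp only [Finset.mem_Icc, Finset.mem_range] at *; omega
      · simp only [Finset.mem_Icc, Finset.mem_range] at *
        rw [show k = 0 by omega, zero_mul]
    · intro i hi; simp only [Finset.mem_Icc] at *; omega
    · intro i hi; simp only [Finset.mem_Icc] at *; omega
    · intro i hi; simp only [Finset.mem_Icc] at *; omega
    · intro i hi; simp only [Finset.mem_Icc] at *; omega
    · intro i hi; rfl
  rw [h1]
  clear h1
  induction μ with
  | zero => simp
  | succ μ ih =>
    rw [Finset.sum_range_succ, Finset.sum_range_succ, ← ih fun i hi => hs i (by omega)]
    obtain ⟨k, hk⟩ := Nat.exists_eq_add_of_le (hs μ (by omega))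
    rw [hk, Nat.add_sub_cancel_left]
    ring

variable {H : ℕ → Matrix (Fin r) (Fin n) F} {H' : (i : ℕ) → Matrix (Fin (s i)) (Fin n) F}

theorem padRows_of_lt {k a : ℕ} (A : Matrix (Fin a) (Fin n) F) (i : Fin k) (h : (i : ℕ) < a) :
    padRows k A i = A ⟨i, h⟩ := funext fun _ => dif_pos h

theorem padRows_of_le {k a : ℕ} (A : Matrix (Fin a) (Fin n) F) (i : Fin k) (h : a ≤ i) :
    padRows k A i = 0 := funext fun _ => dif_neg (not_lt.2 h)

theorem padRows_self {a : ℕ} (A : Matrix (Fin a) (Fin n) F) : padRows a A = A :=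
  funext fun i => padRows_of_lt A i i.2

/-- The degrees of the rows of `G₁`. -/
def rowDegree₁ (r : ℕ) (s : ℕ → ℕ) (μ : ℕ) : Fin r ⊕ Fin (s 0) → ℕ :=
  Sum.elim (fun _ => μ) (fun i => rowDegree s μ i)

theorem rowDegree₁_le (i : Fin r ⊕ Fin (s 0)) : rowDegree₁ r s μ i ≤ μ := by
  rcases i with i | i
  · exact le_rfl
  · exact rowDegree_le _ _ _

/-- The vectors in the rows of `G₁`, indexed by rows and powers of `D`. -/
def blockVectors (μ : ℕ) (H : ℕ → Matrix (Fin r) (Fin n) F)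
    (H' : (i : ℕ) → Matrix (Fin (s i)) (Fin n) F) :
    (i : Fin r ⊕ Fin (s 0)) × Fin (rowDegree₁ r s μ i + 1) → Fin n → F :=
  fun x => Matrix.fromRows (H x.2) (padRows (s 0) (H' x.2)) x.1

/-- The vectors in the rows of `G₂`, indexed by rows and powers of `D`. -/
def lowerVectors (μ : ℕ) (H' : (i : ℕ) → Matrix (Fin (s i)) (Fin n) F) :
    (i : Fin (s 0)) × Fin (rowDegree s μ i + 1) → Fin n → F :=
  fun x => padRows (s 0) (H' x.2) x.1

theorem padRows_eq_zero (hs : ∀ i < μ, s (i + 1) ≤ s i) (i : Fin (s 0)) {l : ℕ}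
    (h : rowDegree s μ i < l) (hl : l ≤ μ) : padRows (s 0) (H' l) i = 0 :=
  padRows_of_le _ _ (not_lt.1 fun h' => absurd ((lt_iff_le_rowDegree hs i.2 hl).1 h') (not_le.2 h))

theorem G₂_eq_stairGen (hs : ∀ i < μ, s (i + 1) ≤ s i) : G₂ μ H' = stairGen (lowerVectors μ H') :=
  polyMatrix_eq_stairGen (fun i => rowDegree_le s μ i) fun i _ h hl => padRows_eq_zero hs i h hl

theorem G₁_eq_stairGen (hs : ∀ i < μ, s (i + 1) ≤ s i) :
    G₁ μ H H' = stairGen (blockVectors μ H H') := by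
  refine polyMatrix_eq_stairGen rowDegree₁_le ?_
  rintro (i | i) l h hl
  · exact absurd h (not_lt.2 hl)
  · exact padRows_eq_zero hs i h hl

theorem linearIndependent_blockVectors (hs : ∀ i < μ, s (i + 1) ≤ s i)
    (hLI : LinearIndependent F (fullMatrix μ H H').row) :
    LinearIndependent F (blockVectors μ H H') := by
  have hlt : ∀ (i : Fin (s 0)) (l : Fin (rowDegree s μ i + 1)), (i : ℕ) < s l := fun i l =>
    (lt_iff_le_rowDegree hs i.2 ((Nat.lt_succ_iff.1 l.2).trans (rowDegree_le s μ i))).2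
      (Nat.lt_succ_iff.1 l.2)
  -- A position (row, power of `D`) in the staircase is sent to the row of the full matrix standing
  -- there; the padded zero rows are never reached.
  let e : (i : Fin r ⊕ Fin (s 0)) × Fin (rowDegree₁ r s μ i + 1) →
      (i : Fin (μ + 1)) × (Fin r ⊕ Fin (s i)) := fun x => match x with
    | ⟨Sum.inl i, l⟩ => ⟨l, Sum.inl i⟩
    | ⟨Sum.inr i, l⟩ => ⟨⟨l, l.2.trans_le (Nat.succ_le_succ (rowDegree_le s μ i))⟩,
        Sum.inr ⟨i, hlt i l⟩⟩
  -- Labels without dependent types, so that injectivity can be checked on natural numbers.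
  let f : (i : Fin (μ + 1)) × (Fin r ⊕ Fin (s i)) → ℕ × (ℕ ⊕ ℕ) :=
    fun y => (y.1, Sum.map Fin.val Fin.val y.2)
  have hfe : ∀ x, f (e x) = ((x.2 : ℕ), Sum.map Fin.val Fin.val x.1) := by
    rintro ⟨i | i, l⟩ <;> rfl
  have hinj : Function.Injective e := by
    rintro ⟨i, l⟩ ⟨i', l'⟩ h
    have h1 := congrArg f h
    rw [hfe, hfe, Prod.mk.injEq] at h1
    obtain rfl : i = i' := Sum.map_injective.2 ⟨Fin.val_injective, Fin.val_injective⟩ h1.2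
    exact congrArg (Sigma.mk i) (Fin.ext h1.1)
  have : blockVectors μ H H' = (fullMatrix μ H H').row ∘ e := by
    funext ⟨i, l⟩
    rcases i with i | i
    · rfl
    · exact padRows_of_lt _ _ (hlt i l)
  rw [this]
  exact hLI.comp e hinj

theorem rank_upper (hLI : LinearIndependent F (fullMatrix μ H H').row) {l : ℕ} (hl : l ≤ μ) :
    (H l).rank = r := by
  have : LinearIndependent F (H l).row :=
    hLI.comp (fun i => ⟨⟨l, Nat.lt_succ_iff.2 hl⟩, Sum.inl i⟩) fun i j h => by simpa using h
  rw [this.rank_matrix, Fintype.card_fin]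

theorem rank_lower (hLI : LinearIndependent F (fullMatrix μ H H').row) {l : ℕ} (hl : l ≤ μ) :
    (H' l).rank = s l := by
  have : LinearIndependent F (H' l).row :=
    hLI.comp (fun i => ⟨⟨l, Nat.lt_succ_iff.2 hl⟩, Sum.inr i⟩) fun i j h => by simpa using h
  rw [this.rank_matrix, Fintype.card_fin]

theorem γ₂_eq (hs : ∀ i < μ, s (i + 1) ≤ s i)
    (hLI : LinearIndependent F (fullMatrix μ H H').row) :
    γ₂ μ H' = ∑ i : Fin (s 0), rowDegree s μ i := by
  rw [sum_rowDegree hs, ← sum_mul_sub_eq s μ hs, γ₂, rank_lower hLI le_rfl]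
  congr 1
  refine Finset.sum_congr rfl fun i hi => ?_
  rw [Finset.mem_Icc] at hi
  rw [rank_lower hLI (by omega), rank_lower hLI (by omega)]

theorem γ₁_eq (hs : ∀ i < μ, s (i + 1) ≤ s i)
    (hLI : LinearIndependent F (fullMatrix μ H H').row) :
    γ₁ μ H H' = ∑ i, rowDegree₁ r s μ i := by
  have h1 : γ₁ μ H H' = μ * (H μ).rank + γ₂ μ H' := by
    rw [γ₁, γ₂, mul_add, add_assoc]
  rw [h1, rank_upper hLI le_rfl, γ₂_eq hs hLI, Fintype.sum_sum_type]
  simp [rowDegree₁, mul_comm]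

end Construction

/-! ### The codes `V₁` and `V₂`, their inclusion and their duals -/

section Construction

variable {r μ : ℕ} {s : ℕ → ℕ} {H : ℕ → Matrix (Fin r) (Fin n) F}
  {H' : (i : ℕ) → Matrix (Fin (s i)) (Fin n) F}

theorem linearIndependent_lowerVectors (hs : ∀ i < μ, s (i + 1) ≤ s i)
    (hLI : LinearIndependent F (fullMatrix μ H H').row) :
    LinearIndependent F (lowerVectors μ H') := by
  let e : (i : Fin (s 0)) × Fin (rowDegree s μ i + 1) →
      (i : Fin r ⊕ Fin (s 0)) × Fin (rowDegree₁ r s μ i + 1) := fun x => ⟨Sum.inr x.1, x.2⟩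
  have he : Function.Injective e := by
    rintro ⟨i, l⟩ ⟨i', l'⟩ h
    cases h
    rfl
  have h : lowerVectors μ H' = blockVectors μ H H' ∘ e := by
    funext ⟨i, l⟩
    rfl
  rw [h]
  exact (linearIndependent_blockVectors hs hLI).comp e he

theorem isRowReduced_G₁ (hs : ∀ i < μ, s (i + 1) ≤ s i)
    (hLI : LinearIndependent F (fullMatrix μ H H').row) :
    IsRowReduced (G₁ μ H H') (rowDegree₁ r s μ) := by
  obtain ⟨m, -, p, q, h, hv⟩ := exists_isDualPair (linearIndependent_blockVectors hs hLI)
  exact G₁_eq_stairGen (H := H) (H' := H') hs ▸ isRowReduced_stairGen h hv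

theorem isBasic_G₁ (hs : ∀ i < μ, s (i + 1) ≤ s i)
    (hLI : LinearIndependent F (fullMatrix μ H H').row) : IsBasic (G₁ μ H H') := by
  obtain ⟨m, -, p, q, h, hv⟩ := exists_isDualPair (linearIndependent_blockVectors hs hLI)
  exact G₁_eq_stairGen (H := H) (H' := H') hs ▸ isBasic_stairGen h hv

theorem isRowReduced_G₂ (hs : ∀ i < μ, s (i + 1) ≤ s i)
    (hLI : LinearIndependent F (fullMatrix μ H H').row) :
    IsRowReduced (G₂ μ H') (fun i => rowDegree s μ i) := by
  obtain ⟨m, -, p, q, h, hv⟩ := exists_isDualPair (linearIndependent_lowerVectors hs hLI)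
  exact G₂_eq_stairGen (H' := H') hs ▸ isRowReduced_stairGen h hv

theorem isBasic_G₂ (hs : ∀ i < μ, s (i + 1) ≤ s i)
    (hLI : LinearIndependent F (fullMatrix μ H H').row) : IsBasic (G₂ μ H') := by
  obtain ⟨m, -, p, q, h, hv⟩ := exists_isDualPair (linearIndependent_lowerVectors hs hLI)
  exact G₂_eq_stairGen (H' := H') hs ▸ isBasic_stairGen h hv

theorem V₂_le_V₁ : V₂ μ H' ≤ V₁ μ H H' := by
  refine rowModule_le_iff.2 fun i => ?_
  have h : G₂ μ H' i = G₁ μ H H' (Sum.inr i) := by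
    rw [G₁, G₂, polyMatrix_row, polyMatrix_row]; rfl
  rw [h]
  exact row_mem_rowModule _ _

/-- The constant word dual to the first row of `H 0` has product one with that row of `G₁` and zero
with all others, in particular with the rows of `G₂`. It serves both for the finiteness of `dz` and
for the strictness of the inclusion. -/
theorem exists_mem_dual_V₂_notMem_dual_V₁ (hr : 0 < r) (hs : ∀ i < μ, s (i + 1) ≤ s i)
    (hLI : LinearIndependent F (fullMatrix μ H H').row) :
    ∃ u, u ∈ dual (V₂ μ H') ∧ u ∉ dual (V₁ μ H H') := by
  obtain ⟨m, -, p, q, h, hv⟩ := exists_isDualPair (linearIndependent_blockVectors hs hLI)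
  have h1 : ∀ i, lprod (constWord (q (Sum.inl ⟨Sum.inl ⟨0, hr⟩, 0⟩))) (G₁ μ H H' i) =
      if i = Sum.inl ⟨0, hr⟩ then 1 else 0 := by
    intro i
    rw [lprod_comm, lprod_constWord_right, G₁_eq_stairGen hs, coordinate_stairGen h hv]
    by_cases hi : i = Sum.inl ⟨0, hr⟩
    · subst hi
      simp only [Sum.inl.injEq, Sigma.mk.injEq, heq_eq_eq, true_and]
      simp [atD]
    · simp [hi, atD]
  refine ⟨constWord (q (Sum.inl ⟨Sum.inl ⟨0, hr⟩, 0⟩)), mem_dual_rowModule.2 fun i => ?_,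
    fun hmem => ?_⟩
  · have h2 : G₂ μ H' i = G₁ μ H H' (Sum.inr i) := by
      rw [G₁, G₂, polyMatrix_row, polyMatrix_row]; rfl
    rw [h2, h1, if_neg (by simp)]
  · have := mem_dual_rowModule.1 hmem (Sum.inl ⟨0, hr⟩)
    rw [h1, if_pos rfl] at this
    exact one_ne_zero this

theorem V₂_lt_V₁ (hr : 0 < r) (hs : ∀ i < μ, s (i + 1) ≤ s i)
    (hLI : LinearIndependent F (fullMatrix μ H H').row) : V₂ μ H' < V₁ μ H H' := by
  refine lt_of_le_not_ge V₂_le_V₁ fun h => ?_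
  obtain ⟨u, hu, hu'⟩ := exists_mem_dual_V₂_notMem_dual_V₁ (H := H) hr hs hLI
  exact hu' (dual_anti h hu)

theorem dual_dual_V₁ (hs : ∀ i < μ, s (i + 1) ≤ s i)
    (hLI : LinearIndependent F (fullMatrix μ H H').row) :
    dual (dual (V₁ μ H H')) = V₁ μ H H' := by
  obtain ⟨m, -, p, q, h, hv⟩ := exists_isDualPair (linearIndependent_blockVectors hs hLI)
  rw [V₁, G₁_eq_stairGen hs, dual_stairGen h hv, dual_stairDual h hv]

/-- The dual of `V₁` has a row reduced basic generator matrix of the same overall constraint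
length as `G₁`. -/
theorem exists_isRowReduced_dual_V₁ (hs : ∀ i < μ, s (i + 1) ≤ s i)
    (hLI : LinearIndependent F (fullMatrix μ H H').row) :
    ∃ (B : Matrix (Fin (n - (r + s 0))) (Fin n) F[X]) (d : Fin (n - (r + s 0)) → ℕ),
      IsRowReduced B d ∧ IsBasic B ∧ rowModule B = dual (V₁ μ H H') ∧
        overallConstraintLength B = γ₁ μ H H' := by
  obtain ⟨m, hm, p, q, h, hv⟩ := exists_isDualPair (linearIndependent_blockVectors hs hLI)
  -- The basis has `∑ (d i + 1) + m = n` members; dropping one for each of the `r + s 0` staircases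
  -- leaves the rows of `stairDual`.
  have hcard : Fintype.card (((i : Fin r ⊕ Fin (s 0)) × Fin (rowDegree₁ r s μ i)) ⊕ Fin m) =
      n - (r + s 0) := by
    rw [Fintype.card_sigma] at hm
    simp only [Fintype.card_fin, Finset.sum_add_distrib, Finset.sum_const, Finset.card_univ,
      Fintype.card_sum, smul_eq_mul, mul_one] at hm
    rw [Fintype.card_sum, Fintype.card_sigma, Fintype.card_fin]
    simp only [Fintype.card_fin]
    omega
  let e := (Fintype.equivFinOfCardEq hcard).symm
  refine ⟨(stairDual q).submatrix e id, _, (isRowReduced_stairDual h).submatrix e.injective,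
    (isBasic_stairDual h).submatrix e.injective, ?_, ?_⟩
  · rw [rowModule_reindex, V₁, G₁_eq_stairGen hs, dual_stairGen h hv]
  · rw [overallConstraintLength_submatrix, overallConstraintLength_stairDual h, γ₁_eq hs hLI]

theorem padRows_eq_zero_or {l : ℕ} (hl : l ≤ μ) (i : Fin (s 0)) :
    padRows (s 0) (H' l) i = 0 ∨ ∃ k, padRows (s 0) (H' l) i = starMatrix μ H' k := by
  by_cases h : (i : ℕ) < s l
  · exact Or.inr ⟨⟨⟨l, Nat.lt_succ_iff.2 hl⟩, ⟨i, h⟩⟩, padRows_of_lt _ _ h⟩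
  · exact Or.inl (padRows_of_le _ _ (not_lt.1 h))

theorem starMatrix_eq_padRows (hs : ∀ i < μ, s (i + 1) ≤ s i)
    (k : (i : Fin (μ + 1)) × Fin (s i)) :
    ∃ l ≤ μ, ∃ i, starMatrix μ H' k = padRows (s 0) (H' l) i := by
  obtain ⟨l, i⟩ := k
  have hl : (l : ℕ) ≤ μ := Nat.lt_succ_iff.1 l.2
  exact ⟨l, hl, ⟨i, i.2.trans_le (antitone_of_step hs (Nat.zero_le _) hl)⟩,
    (padRows_of_lt (H' l) _ i.2).symm⟩

theorem fromRows_eq_zero_or {l : ℕ} (hl : l ≤ μ) (i : Fin r ⊕ Fin (s 0)) :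
    Matrix.fromRows (H l) (padRows (s 0) (H' l)) i = 0 ∨
      ∃ k, Matrix.fromRows (H l) (padRows (s 0) (H' l)) i = fullMatrix μ H H' k := by
  rcases i with i | i
  · exact Or.inr ⟨⟨⟨l, Nat.lt_succ_iff.2 hl⟩, Sum.inl i⟩, rfl⟩
  · by_cases h : (i : ℕ) < s l
    · exact Or.inr ⟨⟨⟨l, Nat.lt_succ_iff.2 hl⟩, Sum.inr ⟨i, h⟩⟩, padRows_of_lt _ _ h⟩
    · exact Or.inl (padRows_of_le _ _ (not_lt.1 h))

end Construction

end AQCC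

/-! ### The main theorem -/

open AQCC
theorem theorem1 {F : Type*} [Field F] [Fintype F] (n μ r : ℕ) (s : ℕ → ℕ)
    (H : ℕ → Matrix (Fin r) (Fin n) F) (H' : (i : ℕ) → Matrix (Fin (s i)) (Fin n) F)
    (hr : 0 < r)
    (hs : ∀ i < μ, s (i + 1) ≤ s i)
    (hm : ∑ i ∈ Finset.range (μ + 1), (r + s i) < n)
    (hLI : LinearIndependent F (fullMatrix μ H H').row) :
    -- the two classical convolutional codes
    IsReducedBasic (G₁ μ H H') ∧ IsReducedBasic (G₂ μ H') ∧
    V₂ μ H' < V₁ μ H H' ∧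
    overallConstraintLength (G₁ μ H H') = γ₁ μ H H' ∧
    overallConstraintLength (G₂ μ H') = γ₂ μ H' ∧
    memory (G₁ μ H H') = μ ∧ (0 < s μ → memory (G₂ μ H') = μ) ∧
    -- the distances of the CSS-type code
    ∃ dz dx : ℕ,
      IsLeast (weight '' ((V₁ μ H H' : Set (Fin n → F[X])) \ V₂ μ H')) dx ∧
      IsLeast (weight '' ((dual (V₂ μ H') : Set (Fin n → F[X])) \ dual (V₁ μ H H'))) dz ∧
      freeDist (V₁ μ H H') ≤ dx ∧
      minDist (blockDual (codeOfParityCheck (fullMatrix μ H H'))) ≤ freeDist (V₁ μ H H') ∧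
      freeDist (dual (V₂ μ H')) ≤ dz ∧
      min (minDist (codeOfParityCheck (H' 0)) +
            minDist (codeOfParityCheck (padRows (s 0) (H' μ))))
          (minDist (codeOfParityCheck (starMatrix μ H'))) ≤ freeDist (dual (V₂ μ H')) ∧
      freeDist (dual (V₂ μ H')) ≤ minDist (codeOfParityCheck (starMatrix μ H')) ∧
      -- the quantum code, and the same code with the roles of flips and phase shifts exchanged
      (∃ H₁ : Matrix (Fin (n - (r + s 0))) (Fin n) F[X],
        IsReducedBasicGenerator H₁ (dual (V₁ μ H H'))) ∧
      ∀ H₁ : Matrix (Fin (n - (r + s 0))) (Fin n) F[X],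
        IsReducedBasicGenerator H₁ (dual (V₁ μ H H')) →
        ∃ μstar : ℕ,
          IsAQCC (cssMatrix (G₂ μ H') H₁) (H 0).rank μstar (γ₁ μ H H' + γ₂ μ H') dz dx ∧
          IsAQCC (cssMatrix H₁ (G₂ μ H')) (H 0).rank μstar (γ₁ μ H H' + γ₂ μ H') dx dz := by
  have hrr₁ := isRowReduced_G₁ hs hLI
  have hrr₂ := isRowReduced_G₂ hs hLI
  have hb₂ := isBasic_G₂ hs hLI
  have hR₁ := hrr₁.isReducedBasic (isBasic_G₁ hs hLI)
  have hR₂ := hrr₂.isReducedBasic hb₂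
  have hlt := V₂_lt_V₁ hr hs hLI
  have hγ₁ : overallConstraintLength (G₁ μ H H') = γ₁ μ H H' := by
    rw [hrr₁.overallConstraintLength_eq, γ₁_eq hs hLI]
  have hγ₂ : overallConstraintLength (G₂ μ H') = γ₂ μ H' := by
    rw [hrr₂.overallConstraintLength_eq, γ₂_eq hs hLI]
  have hmem₂ : 0 < s μ → memory (G₂ μ H') = μ := fun hpos => by
    have h0 : 0 < s 0 := hpos.trans_le (antitone_of_step hs (Nat.zero_le _) le_rfl)
    exact hrr₂.memory_eq (fun i => rowDegree_le s μ i) ⟨0, h0⟩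
      ((rowDegree_le s μ 0).antisymm ((lt_iff_le_rowDegree hs h0 le_rfl).1 hpos))
  obtain ⟨dx, hdx⟩ : ∃ k, IsLeast (weight '' ((V₁ μ H H' : Set (Fin n → F[X])) \ V₂ μ H')) k := by
    obtain ⟨v, hv, hv'⟩ := SetLike.exists_of_lt hlt
    exact exists_isLeast_of_nonempty ⟨_, v, ⟨hv, hv'⟩, rfl⟩
  obtain ⟨dz, hdz⟩ : ∃ k, IsLeast
      (weight '' ((dual (V₂ μ H') : Set (Fin n → F[X])) \ dual (V₁ μ H H'))) k := by
    obtain ⟨v, hv, hv'⟩ := exists_mem_dual_V₂_notMem_dual_V₁ hr hs hLI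
    exact exists_isLeast_of_nonempty ⟨_, v, ⟨hv, hv'⟩, rfl⟩
  -- One row reduced generator of the dual of `V₁`, with which an arbitrary reduced basic `H₁` is
  -- compared below.
  obtain ⟨B, d, hB, hbB, hBV, hBγ⟩ := exists_isRowReduced_dual_V₁ hs hLI
  refine ⟨hR₁, hR₂, hlt, hγ₁, hγ₂, hrr₁.memory_eq rowDegree₁_le (Sum.inl ⟨0, hr⟩) rfl, hmem₂,
    dz, dx, hdx, hdz, freeDist_le_of_isLeast hdx,
    minDist_blockDual_le_freeDist _ fun l hl i => fromRows_eq_zero_or hl i,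
    freeDist_le_of_isLeast hdz, ?_,
    freeDist_dual_le_minDist _ fun l hl i => padRows_eq_zero_or hl i,
    ⟨B, hB.isReducedBasic hbB, hBV⟩, ?_⟩
  · have := min_minDist_le_freeDist_dual (A := fun i => padRows (s 0) (H' i)) (starMatrix μ H')
      (starMatrix_eq_padRows hs)
    -- The block `H' 0` already has `s 0` rows, so its padding is void.
    simp only [padRows_self] at this
    exact this
  · rintro H₁ ⟨hH₁, hV⟩
    have hdual : dual (rowModule H₁) = V₁ μ H H' := by rw [hV, dual_dual_V₁ hs hLI]
    have horth : ∀ i k, lprod (H₁ k) (G₂ μ H' i) = 0 := fun i k =>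
      mem_dual_rowModule.1 (dual_anti V₂_le_V₁ (hV ▸ row_mem_rowModule H₁ k)) i
    have hγ : overallConstraintLength H₁ = γ₁ μ H H' := by
      rw [← hBγ, hH₁.overallConstraintLength_eq (hB.isReducedBasic hbB) (hV.trans hBV.symm)]
    -- The bound `r + s 0 ≤ n` keeps `n - (r + s 0)` from being truncated.
    have hrows : s 0 + (n - (r + s 0)) + (H 0).rank = n := by
      have h0 : r + s 0 ≤ ∑ i ∈ Finset.range (μ + 1), (r + s i) :=
        Finset.single_le_sum (f := fun i => r + s i) (fun _ _ => Nat.zero_le _)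
          (Finset.mem_range.2 (Nat.succ_pos μ))
      rw [rank_upper hLI (Nat.zero_le μ)]
      omega
    refine ⟨memory (cssMatrix (G₂ μ H') H₁), ⟨isSymplecticOrthogonal_cssMatrix horth,
      hR₂.cssMatrix hH₁ hrr₂ hb₂ rfl hB hbB (hV.trans hBV.symm), ?_, rfl, ?_, ?_⟩,
      ⟨isSymplecticOrthogonal_cssMatrix fun i k => ?_,
      hH₁.cssMatrix hR₂ hB hbB (hV.trans hBV.symm) hrr₂ hb₂ rfl, ?_, ?_, ?_, ?_⟩⟩
    · simpa using hrows
    · rw [overallConstraintLength_cssMatrix, hγ, hγ₂, add_comm]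
    · refine hasFreeDistances_cssMatrix ?_ ?_
      · rw [hdual]; exact hdx
      · rw [hV]; exact hdz
    · rw [lprod_comm, horth, map_zero]
    · rw [Fintype.card_sum, Fintype.card_fin, Fintype.card_fin]
      omega
    · rw [memory_cssMatrix, memory_cssMatrix, max_comm]
    · rw [overallConstraintLength_cssMatrix, hγ, hγ₂]
    · refine hasFreeDistances_cssMatrix ?_ ?_
      · rw [hV]; exact hdz
      · rw [hdual]; exact hdx
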